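/- Let $G=(V,E)$ be a connected, countably infinite graph of bounded degree, with maximal degree $D$. Let $p_w,p_g,p_r\ge 0$ with $p_w+p_g+p_r=1$. Each vertex $v$ independently has initial colour $c(v)$ equal to white, green or red with probability $p_w,p_g,p_r$, respectively, and, independently of the colours, the edges $e$ carry i.i.d. opening times $\tau(e)$, exponentially distributed with mean $1$. Let $\xi_v(p)$ be the expected number of vertices of the occupied cluster of $v$ in site percolation on $G$ with parameter $p$, and $\xi(p)=\sup_v\xi_v(p)$. For an initially white vertex $v$ let $C_w(v)$ be the maximal connected set of initially white vertices containing $v$, and let $\partial C_w(v)$ be the set of vertices outside $C_w(v)$ with a neighbour in it. **Algorithm**, started from an initially green vertex $x$. It keeps disjoint trees, collected in $\mathcal T_a$ (active) and $\mathcal T_p$ (paralyzing), a set $S$ of initially white vertices that have been seen, a set $\mathcal E$ of candidate edges with tentative times $t_1(e)$, opening times $t(e)$ of edges, and times $t_g(v)$, $t_r(v)$. A vertex is *fresh* if it is in no tree and not in $S$. * *Start:* $\mathcal T_p=\emptyset$, $\mathcal T_a=\{\{x\}\}$, $S=\emptyset$, $t_g(x)=0$, $\mathcal E$ is the set of edges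 incident to $x$, and $t_1=\tau$ on $\mathcal E$. * *Round:* Remove from $\mathcal E$ all edges with both endpoints in the same active tree. If $\mathcal E=\emptyset$, stop. Otherwise select $e=\langle v,y\rangle\in\mathcal E$ with minimal $t_1(e)$ (ties are broken by a fixed enumeration), with $v$ in an active tree $T$. In all cases except 3 below, set $t(e)=t_1(e)$. 1. $y$ fresh and red: set $t_r(y)=0$, add $\{y\}$ to $\mathcal T_p$, and continue as in 4. 2. $y$ fresh and green: set $t_g(y)=0$, add the edges $e'\notin\mathcal E$ incident to $y$ to $\mathcal E$ with $t_1(e')=\tau(e')$, and glue $y$ to $T$ by $e$. 3. $y$ fresh and white: add $C_w(y)$ to $S$. Every green $z\in\partial C_w(y)$ that is in no tree gets $t_g(z)=0$ and becomes a new active tree $\{z\}$, and the edges $e'\notin\mathcal E$ incident to $z$ are added to $\mathcal E$ with $t_1(e')=\tau(e')$. Every red $z\in\partial C_w(y)$ not in a paralyzing tree gets $t_r(z)=0$ and becomes a new paralyzing tree $\{z\}$. 4. $y$ in a paralyzing tree $T'$: set $t_r(z)=t(e)$ for all $z\in T$, remove from $\mathcal E$ all edges with one endpoint in $T$ and the other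 endpoint in no active tree, remove $T$ from $\mathcal T_a$, and replace $T'$ in $\mathcal T_p$ by the tree obtained by gluing $T$ and $T'$ together via $e$. 5. $y$ in an active tree $T'$: replace $T$ and $T'$ in $\mathcal T_a$ by the tree obtained by gluing them together via $e$. 6. $y\in S$ in no tree: set $t_g(y)=t(e)$, glue $y$ to $T$ by $e$, and add every edge $e'=\langle y,z\rangle\notin\mathcal E$ to $\mathcal E$, with $t_1(e')=t(e)+\tau(e')-(t_r(z)-t_g(z))$ if $z$ is in a paralyzing tree and $c(z)$ is not red, and $t_1(e')=t(e)+\tau(e')$ otherwise. If the algorithm stops, let $H$ be the subgraph of $G$ induced by the vertices that are then in a paralyzing tree or in $S$ (if it never stops, put $H=G$). **Proposition.** Suppose that $(D-1)\,\xi(p_w)<p_r$. Then, for every vertex $x$, conditionally on $x$ being initially green, the algorithm started from $x$ stops almost surely. Moreover, the distributions of the number of vertices of $H$ and of the diameter of $H$ (measured by the graph distance of $H$, and also by that of $G$) have exponential tails: for each of these quantities $X$ there are constants $C,a>0$ with $P(X\ge n\mid c(x)=\text{green})\le Ce^{-an}$ for all $n\ge 0$. -/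

import Mathlib

open MeasureTheory ProbabilityTheory Set
open scoped ENNReal

namespace ParalyzingGrowth

noncomputable section

open scoped Classical

/-- The initial colours of the vertices. -/
inductive Colour where
  | white
  | green
  | red

instance : MeasurableSpace Colour := ⊤

variable {V : Type*} (G : SimpleGraph V)

/-! ### Clusters, site percolation, diameter -/

/-- The cluster of `v` in the vertex set `A`: all vertices joined to `v` by a path of `G` all of
whose vertices (including `v`) lie in `A`. It is empty if `v ∉ A`. -/
def cluster (A : Set V) (v : V) : Set V :=
  {u | ∃ p : G.Walk v u, ∀ w ∈ p.support, w ∈ A}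

/-- The outer vertex boundary of `W`: vertices outside `W` having a neighbour in `W`. -/
def vertexBoundary (W : Set V) : Set V :=
  {z | z ∉ W ∧ ∃ w ∈ W, G.Adj w z}

/-- `ξ_v(p)`: the expected number of vertices of the occupied cluster of `v` in site percolation
on `G` with parameter `p` (every vertex is occupied with probability `p`, independently). -/
def xiAt (p : unitInterval) (v : V) : ℝ≥0∞ :=
  ∫⁻ A, ((cluster G A v).encard : ℝ≥0∞) ∂(setBernoulli (univ : Set V) p)

/-- `ξ(p) = sup_v ξ_v(p)`. -/
def xi (p : unitInterval) : ℝ≥0∞ := ⨆ v, xiAt G p v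

/-- The diameter of a set of vertices with respect to the graph distance of `G`. -/
def setDiam (W : Set V) : ℕ∞ := ⨆ u ∈ W, ⨆ v ∈ W, G.edist u v

/-! ### The random input -/

/-- The law of one initial colour: white, green, red with probabilities `pw`, `pg`, `pr`. -/
def colourLaw (pw pg pr : unitInterval) : Measure Colour :=
  ENNReal.ofReal pw • Measure.dirac Colour.white +
    ENNReal.ofReal pg • Measure.dirac Colour.green +
    ENNReal.ofReal pr • Measure.dirac Colour.red

/-- The input of the algorithm: initial colours of the vertices and opening times of the edges. -/
abbrev Input : Type _ := (V → Colour) × (G.edgeSet → ℝ)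

/-- The law of the input: independent initial colours with law `colourLaw pw pg pr` and
exponential (mean `1`) opening times, everything independent. -/
def inputLaw (pw pg pr : unitInterval) : Measure (Input G) :=
  (Measure.infinitePi fun _ : V => colourLaw pw pg pr).prod
    (Measure.infinitePi fun _ : G.edgeSet => expMeasure 1)

/-- The law of the input conditioned on `x` being initially green. -/
def inputLawGreen (pw pg pr : unitInterval) (x : V) : Measure (Input G) :=
  ProbabilityTheory.cond (inputLaw G pw pg pr) {ω | ω.1 x = Colour.green}

/-! ### The administration of the algorithm -/

/-- The data kept by the algorithm. The functions `tGreen`, `tRed`, `tOpen`, `tOne` carry the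
value `0` where nothing has been assigned; the algorithm only reads assigned values. -/
@[ext]
structure State where
  /-- the collection of active trees -/
  active : Set G.Subgraph
  /-- the collection of paralyzing trees -/
  paral : Set G.Subgraph
  /-- the initially white vertices seen so far -/
  seen : Set V
  /-- the current set of candidate edges -/
  cand : Set G.edgeSet
  /-- the tentative opening times of the candidate edges -/
  tOne : G.edgeSet → ℝ
  /-- the opening times of edges -/
  tOpen : G.edgeSet → ℝ
  /-- the times at which vertices become green -/
  tGreen : V → ℝ
  /-- the times at which vertices become red -/
  tRed : V → ℝ

variable {G}

/-- The vertices of the trees of a collection `F`. -/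
def vertsOf (F : Set G.Subgraph) : Set V := ⋃ T ∈ F, T.verts

/-- The tree of the collection `F` that contains `v` (the trees of a collection are disjoint, so
there is at most one). -/
def treeAt (F : Set G.Subgraph) (v : V) : G.Subgraph := sSup {T ∈ F | v ∈ T.verts}

/-- The undirected edge of a directed edge. -/
def dartEdge (d : G.Dart) : G.edgeSet := ⟨d.edge, d.edge_mem⟩

namespace State

/-- Vertices that are in no tree and were not seen as white vertices. -/
def Fresh (s : State G) (y : V) : Prop :=
  y ∉ vertsOf s.active ∧ y ∉ vertsOf s.paral ∧ y ∉ s.seen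

/-- Add to `cand` all edges incident to a vertex of `Z` that are not yet there, and give each such
new edge the value `f` as tentative opening time. -/
def addEdges (s : State G) (Z : Set V) (f : G.edgeSet → ℝ) : State G :=
  { s with
    cand := s.cand ∪ {e | ∃ z ∈ Z, z ∈ e.1}
    tOne := fun e => if e ∉ s.cand ∧ ∃ z ∈ Z, z ∈ e.1 then f e else s.tOne e }

/-- Set the opening time of `e` to its tentative opening time. -/
def setOpen (s : State G) (e : G.edgeSet) : State G :=
  { s with tOpen := Function.update s.tOpen e (s.tOne e) }

/-- Remove all candidate edges with both endpoints in the same active tree. -/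
def clean (s : State G) : State G :=
  { s with cand := {e ∈ s.cand | ¬ ∃ T ∈ s.active, ∀ u ∈ e.1, u ∈ T.verts} }

end State

open State

/-! ### The actions of the algorithm -/

/-- Initialization: one active tree, consisting of `x` only. -/
def initState (τ : G.edgeSet → ℝ) (x : V) : State G where
  active := {G.singletonSubgraph x}
  paral := ∅
  seen := ∅
  cand := {e | x ∈ e.1}
  tOne := fun e => if x ∈ e.1 then τ e else 0
  tOpen := fun _ => 0
  tGreen := fun _ => 0
  tRed := fun _ => 0

/-- The vertex `y` of the selected edge `d = ⟨v, y⟩` is in a paralyzing tree `T'`: the active tree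
`T` of `v` becomes paralyzed and is glued to `T'`. -/
def actParalyze (s : State G) (d : G.Dart) : State G :=
  let T := treeAt s.active d.fst
  let T' := treeAt s.paral d.snd
  { s with
    tRed := fun z => if z ∈ T.verts then s.tOpen (dartEdge d) else s.tRed z
    cand := s.cand \ {e | ∃ u w, e.1 = s(u, w) ∧ u ∈ T.verts ∧ w ∉ vertsOf s.active}
    paral := insert (T ⊔ T' ⊔ G.subgraphOfAdj d.adj) (s.paral \ {T'})
    active := s.active \ {T} }

/-- The vertex `y` is fresh and red. -/
def actFreshRed (s : State G) (d : G.Dart) : State G :=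
  actParalyze
    { s with
      tRed := Function.update s.tRed d.snd 0
      paral := insert (G.singletonSubgraph d.snd) s.paral } d

/-- The vertex `y` is glued to the active tree of `v` by the selected edge. -/
def glueVertex (s : State G) (d : G.Dart) : State G :=
  let T := treeAt s.active d.fst
  { s with active := insert (T ⊔ G.subgraphOfAdj d.adj) (s.active \ {T}) }

/-- The vertex `y` is fresh and green. -/
def actFreshGreen (τ : G.edgeSet → ℝ) (s : State G) (d : G.Dart) : State G :=
  glueVertex
    (addEdges { s with tGreen := Function.update s.tGreen d.snd 0 } {d.snd} τ) d

/-- The vertex `y` is in an active tree: it is joined with the active tree of `v`. -/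
def actJoin (s : State G) (d : G.Dart) : State G :=
  let T := treeAt s.active d.fst
  let T' := treeAt s.active d.snd
  { s with active := insert (T ⊔ T' ⊔ G.subgraphOfAdj d.adj) (s.active \ {T, T'}) }

/-- The white cluster of a vertex: empty if the vertex is not initially white. -/
def whiteCluster (G : SimpleGraph V) (c : V → Colour) (v : V) : Set V :=
  cluster G {u | c u = Colour.white} v

/-- The vertex `y` is fresh and white: its white cluster is recorded as seen; the green vertices
of the boundary of this cluster that are in no tree start new active trees, and the red vertices of
this boundary that are in no paralyzing tree start new paralyzing trees. -/
def actFreshWhite (c : V → Colour) (τ : G.edgeSet → ℝ) (s : State G) (y : V) : State G :=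
  let W := whiteCluster G c y
  let Zg := {z ∈ vertexBoundary G W |
    c z = Colour.green ∧ z ∉ vertsOf s.active ∧ z ∉ vertsOf s.paral}
  let Zr := {z ∈ vertexBoundary G W | c z = Colour.red ∧ z ∉ vertsOf s.paral}
  addEdges
    { s with
      seen := s.seen ∪ W
      tGreen := fun z => if z ∈ Zg then 0 else s.tGreen z
      active := s.active ∪ (fun z => G.singletonSubgraph z) '' Zg
      tRed := fun z => if z ∈ Zr then 0 else s.tRed z
      paral := s.paral ∪ (fun z => G.singletonSubgraph z) '' Zr }
    Zg τ

/-- The vertex `y` is a white vertex seen before that is in no tree: it becomes green at the opening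
time of the selected edge and is glued to the active tree of `v`. A new candidate edge `⟨y, z⟩`
whose other end `z` is in a paralyzing tree and not initially red has already had a green endpoint
during a time `tRed z - tGreen z`. -/
def actSeenWhite (c : V → Colour) (τ : G.edgeSet → ℝ) (s : State G) (d : G.Dart) : State G :=
  let y := d.snd
  let t := s.tOpen (dartEdge d)
  let f : G.edgeSet → ℝ := fun e =>
    if h : y ∈ e.1 then
      let z := Sym2.Mem.other h
      if z ∈ vertsOf s.paral ∧ c z ≠ Colour.red then t + τ e - (s.tRed z - s.tGreen z)
      else t + τ e
    else 0
  glueVertex (addEdges { s with tGreen := Function.update s.tGreen y t } {y} f) d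

/-- The directed edge `d = ⟨v, y⟩` is selected: its edge is a candidate, `v` is in an active tree,
and the tentative opening time is minimal. Possible ties (and the orientation of a candidate edge
with both endpoints in active trees) are decided by the enumeration `enc` of the directed edges. -/
def Selected (enc : G.Dart → ℕ) (s : State G) (d : G.Dart) : Prop :=
  (dartEdge d ∈ s.cand ∧ d.fst ∈ vertsOf s.active) ∧
    ∀ d' : G.Dart, dartEdge d' ∈ s.cand → d'.fst ∈ vertsOf s.active →
      s.tOne (dartEdge d) < s.tOne (dartEdge d') ∨
        (s.tOne (dartEdge d) = s.tOne (dartEdge d') ∧ enc d ≤ enc d')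

/-- What the algorithm does once the edge `d = ⟨v, y⟩` has been selected. -/
def act (ω : Input G) (s : State G) (d : G.Dart) : State G :=
  let y := d.snd
  if s.Fresh y then
    match ω.1 y with
    | Colour.red => actFreshRed (s.setOpen (dartEdge d)) d
    | Colour.green => actFreshGreen ω.2 (s.setOpen (dartEdge d)) d
    | Colour.white => actFreshWhite ω.1 ω.2 s y
  else if y ∈ vertsOf s.paral then actParalyze (s.setOpen (dartEdge d)) d
  else if y ∈ vertsOf s.active then actJoin (s.setOpen (dartEdge d)) d
  else actSeenWhite ω.1 ω.2 (s.setOpen (dartEdge d)) d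

/-- One round: clean up the candidate edges, select a minimal one and act. If no edge can be
selected (in particular if the algorithm has stopped) nothing else happens. -/
def step (enc : G.Dart → ℕ) (ω : Input G) (s : State G) : State G :=
  if h : ∃ d, Selected enc s.clean d then act ω s.clean h.choose else s.clean

/-- The state after `n` rounds of the algorithm started from `x`. -/
def run (enc : G.Dart → ℕ) (ω : Input G) (x : V) (n : ℕ) : State G :=
  (step enc ω)^[n] (initState ω.2 x)

/-- The stopping criterion: after the clean-up there is no candidate edge. -/
def State.Stopped (s : State G) : Prop := s.clean.cand = ∅

/-- The algorithm started from `x` stops. -/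
def Stops (enc : G.Dart → ℕ) (ω : Input G) (x : V) : Prop :=
  ∃ n, (run enc ω x n).Stopped

/-- The graph `H` produced by the algorithm: the subgraph of `G` induced by the vertices that, when
the algorithm stops, are in a paralyzing tree or have been seen as white vertices. If the algorithm
does not stop, it is put equal to the whole graph. -/
def outputGraph (enc : G.Dart → ℕ) (ω : Input G) (x : V) : G.Subgraph :=
  if h : Stops enc ω x then
    (⊤ : G.Subgraph).induce
      (vertsOf (run enc ω x (Nat.find h)).paral ∪ (run enc ω x (Nat.find h)).seen)
  else ⊤

/-- The random variable `X` has, under `μ`, an exponential tail. -/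
def HasExpTail {Ω : Type*} [MeasurableSpace Ω] (μ : Measure Ω) (X : Ω → ℕ∞) : Prop :=
  ∃ C a : ℝ, 0 < C ∧ 0 < a ∧
    ∀ n : ℕ, μ {ω | (n : ℕ∞) ≤ X ω} ≤ ENNReal.ofReal (C * Real.exp (-a * n))

end

end ParalyzingGrowth

namespace ParalyzingGrowth

noncomputable section

open scoped Classical

universe u

variable {V : Type u} {G : SimpleGraph V}

section

/-! ### Clusters -/

/-! Call region the set of vertices that are in a tree or have been seen as white. The proof is a
deterministic count of colours in the region, followed by a change of measure.

The count (`Inv.count`): a fresh red vertex costs an active tree, and exploring a white cluster `W`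
creates at most `(D - 1) * |W|` new active trees and new red vertices together
(`ncard_boundary_le`). Hence at all times the number of active trees plus the number of red vertices
of the region is at most `1 + (D - 1) * #white`. For a large region this is atypical as soon as `(D
- 1) * pw < pr`.

The change of measure: for some `t > 1` the weights `t ^ (D - 1)`, `1`, `t⁻¹` on white, green, red
have mean `M < 1` (`exists_tilted_law`); let `q` be the normalised weighted colour law. The run up
to round `n` depends on the colours only through those in the region after round `n` (`run_congr`).
So the event that this region is `A`, with given colours on `A`, is at most `t * M ^ |A|` times as
likely as under `q` (`prod_le_of_tilt`). These events are disjoint, so summing over `|A| ≥ m` gives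
`t * M ^ m` (`inputLaw_region_le`), without any counting of the sets `A`.

From regions to the output (`exists_le_region`): as long as the algorithm runs, a potential forces
at least `n / 3` vertices into the region after `n` rounds. When it stops, no active tree is left
because `V` is infinite, so `H` is induced by the region, which is connected; its size bounds both
diameters.

The hypothesis on `ξ` enters through two consequences: `ξ < ∞` makes the white clusters almost
surely finite, and `ξ(pw) ≥ pw` gives `(D - 1) * pw < pr`. -/

theorem cluster_mono {A B : Set V} (h : A ⊆ B) (v : V) : cluster G A v ⊆ cluster G B v := by
  rintro u ⟨p, hp⟩
  exact ⟨p, fun w hw => h (hp w hw)⟩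

theorem mem_cluster_self {A : Set V} {v : V} (h : v ∈ A) : v ∈ cluster G A v :=
  ⟨SimpleGraph.Walk.nil, by simpa using h⟩

theorem cluster_subset (A : Set V) (v : V) : cluster G A v ⊆ A := by
  rintro u ⟨p, hp⟩
  exact hp u p.end_mem_support

theorem mem_cluster_trans {A : Set V} {u v w : V} (h : u ∈ cluster G A v)
    (h' : w ∈ cluster G A u) : w ∈ cluster G A v := by
  obtain ⟨p, hp⟩ := h
  obtain ⟨q, hq⟩ := h'
  refine ⟨p.append q, fun z hz => ?_⟩
  rw [SimpleGraph.Walk.mem_support_append_iff] at hz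
  exact hz.elim (hp z) (hq z)

theorem mem_cluster_symm {A : Set V} {u v : V} (h : u ∈ cluster G A v) : v ∈ cluster G A u := by
  obtain ⟨p, hp⟩ := h
  exact ⟨p.reverse, fun z hz => hp z (by simpa using hz)⟩

theorem mem_cluster_adj {A : Set V} {u v w : V} (h : u ∈ cluster G A v) (ha : G.Adj u w)
    (hw : w ∈ A) : w ∈ cluster G A v := by
  refine mem_cluster_trans h ⟨SimpleGraph.Walk.cons ha SimpleGraph.Walk.nil, ?_⟩
  simpa using ⟨cluster_subset _ _ h, hw⟩

/-- Each vertex of a path in `A` from `v` is reached by an initial segment of it, so the path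
already stays in the cluster. -/
theorem mem_cluster_cluster {A : Set V} {u v : V} (h : u ∈ cluster G A v) :
    u ∈ cluster G (cluster G A v) v := by
  obtain ⟨p, hp⟩ := h
  refine ⟨p, fun w hw => ⟨p.takeUntil w hw, fun z hz => hp z ?_⟩⟩
  exact p.support_takeUntil_subset_support hw hz

theorem mem_of_walk {A S : Set V} (hS : ∀ a ∈ S, ∀ b ∈ A, G.Adj a b → b ∈ S) {v u : V}
    (p : G.Walk v u) (hp : ∀ w ∈ p.support, w ∈ A) (hv : v ∈ S) : u ∈ S := by
  induction p with
  | nil => exact hv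
  | cons h p ih =>
    simp only [SimpleGraph.Walk.support_cons, List.mem_cons, forall_eq_or_imp] at hp
    exact ih hp.2 (hS _ hv _ (hp.2 _ p.start_mem_support) h)

theorem exists_adj_of_mem_cluster {A : Set V} {u v : V} (h : u ∈ cluster G A v) (hne : u ≠ v) :
    ∃ w ∈ cluster G A v, G.Adj u w := by
  obtain ⟨p, hp⟩ := mem_cluster_symm (mem_cluster_cluster h)
  cases p with
  | nil => exact absurd rfl hne
  | cons ha p => exact ⟨_, hp _ (by simp), ha⟩

/-- A path in `A'` that left the cluster would do so through a boundary vertex, which would then lie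
in `A` and hence in the cluster. So exploring a cluster reveals only the cluster and its boundary.
-/
theorem cluster_congr {A A' : Set V} {v : V} (hv : v ∈ A)
    (h : ∀ w ∈ cluster G A v ∪ vertexBoundary G (cluster G A v), w ∈ A ↔ w ∈ A') :
    cluster G A v = cluster G A' v := by
  apply Subset.antisymm
  · intro u hu
    exact cluster_mono (fun w hw => (h w (Or.inl hw)).1 (cluster_subset _ _ hw)) v
      (mem_cluster_cluster hu)
  · rintro u ⟨p, hp⟩
    refine mem_of_walk (A := A') (fun a ha b hb hab => ?_) p hp (mem_cluster_self hv)
    by_contra hbn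
    exact hbn (mem_cluster_adj ha hab ((h b (Or.inr ⟨hbn, a, ha, hab⟩)).2 hb))

theorem white_of_mem_whiteCluster {c : V → Colour} {u v : V} (h : u ∈ whiteCluster G c v) :
    c u = Colour.white := cluster_subset {w | c w = Colour.white} v h

theorem not_white_of_mem_vertexBoundary {c : V → Colour} {z v : V}
    (h : z ∈ vertexBoundary G (whiteCluster G c v)) : c z ≠ Colour.white := by
  obtain ⟨hz, w, hw, ha⟩ := h
  exact fun hc => hz (mem_cluster_adj hw ha hc)

theorem whiteCluster_eq_of_mem {c : V → Colour} {u v : V} (h : u ∈ whiteCluster G c v) :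
    whiteCluster G c u = whiteCluster G c v :=
  Subset.antisymm (fun _ hw => mem_cluster_trans h hw)
    (fun _ hw => mem_cluster_trans (mem_cluster_symm h) hw)

/-- The boundary of a finite cluster, with one neighbour of its root left out, is at most `D - 1`
times as large as the cluster. -/
theorem ncard_boundary_le {D : ℕ}
    (hdeg : ∀ v, (G.neighborSet v).Finite ∧ (G.neighborSet v).ncard ≤ D)
    {A : Set V} {v y : V} (hfin : (cluster G A y).Finite) (hvy : G.Adj v y)
    {Z : Set V} (hZ : Z ⊆ vertexBoundary G (cluster G A y)) (hv : v ∉ Z) :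
    Z.Finite ∧ Z.ncard ≤ (D - 1) * (cluster G A y).ncard := by
  set W := cluster G A y with hW
  have hsub : Z ⊆ ⋃ u ∈ hfin.toFinset, G.neighborSet u \ insert v W := by
    intro z hz
    obtain ⟨hzW, w, hw, ha⟩ := hZ hz
    simp only [Set.Finite.mem_toFinset, mem_iUnion]
    refine ⟨w, hw, ha, ?_⟩
    rintro (rfl | h)
    · exact hv hz
    · exact hzW h
  have hfu : ∀ u, (G.neighborSet u \ insert v W).Finite := fun u => (hdeg u).1.sdiff
  have hcard : ∀ u ∈ hfin.toFinset, (hfu u).toFinset.card ≤ D - 1 := by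
    intro u hu
    rw [Set.Finite.mem_toFinset] at hu
    rw [← Set.ncard_eq_toFinset_card _ (hfu u)]
    -- One neighbour of `u` never counts: `v` if `u` is the root, otherwise a neighbour inside the
    -- cluster. This turns `D` into `D - 1`.
    obtain ⟨w, hw, ha⟩ : ∃ w ∈ insert v W, G.Adj u w := by
      by_cases huy : u = y
      · exact ⟨v, mem_insert _ _, huy ▸ hvy.symm⟩
      · obtain ⟨w, hw, ha⟩ := exists_adj_of_mem_cluster hu huy
        exact ⟨w, mem_insert_of_mem _ hw, ha⟩
    have h1 : (G.neighborSet u \ insert v W).ncard < (G.neighborSet u).ncard := by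
      refine Set.ncard_lt_ncard ?_ (hdeg u).1
      refine ⟨sdiff_subset, fun hh => ?_⟩
      exact (hh (show w ∈ G.neighborSet u from ha)).2 hw
    have := (hdeg u).2
    omega
  have hZ' : Z ⊆ (hfin.toFinset.biUnion fun u => (hfu u).toFinset : Finset V) := by
    intro z hz
    simpa using hsub hz
  have hZf : Z.Finite := (Finset.finite_toSet _).subset hZ'
  refine ⟨hZf, ?_⟩
  have := Set.ncard_le_ncard hZ' (Finset.finite_toSet _)
  rw [Set.ncard_coe_finset] at this
  refine this.trans ((Finset.card_biUnion_le_card_mul _ _ _ hcard).trans ?_)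
  rw [Set.ncard_eq_toFinset_card _ hfin, mul_comm]

/-! ### Collections of trees -/

theorem mem_vertsOf {F : Set G.Subgraph} {v : V} : v ∈ vertsOf F ↔ ∃ T ∈ F, v ∈ T.verts := by
  simp [vertsOf]

theorem vertsOf_insert (F : Set G.Subgraph) (T : G.Subgraph) :
    vertsOf (insert T F) = T.verts ∪ vertsOf F := by
  simp [vertsOf]

theorem vertsOf_union (F F' : Set G.Subgraph) : vertsOf (F ∪ F') = vertsOf F ∪ vertsOf F' := by
  exact biUnion_union F F' _

theorem vertsOf_singletons (Z : Set V) :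
    vertsOf ((fun z => G.singletonSubgraph z) '' Z) = Z := by
  ext v
  simp [vertsOf]

theorem mem_verts_treeAt {F : Set G.Subgraph} {v w : V} :
    w ∈ (treeAt F v).verts ↔ ∃ T ∈ F, v ∈ T.verts ∧ w ∈ T.verts := by
  simp [treeAt, and_assoc]

theorem treeAt_eq {F : Set G.Subgraph}
    (hF : ∀ T ∈ F, ∀ T' ∈ F, ∀ v, v ∈ T.verts → v ∈ T'.verts → T = T')
    {T : G.Subgraph} (hT : T ∈ F) {v : V} (hv : v ∈ T.verts) : treeAt F v = T := by
  have : {S ∈ F | v ∈ S.verts} = {T} := by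
    ext S
    simp only [mem_ofPred_eq, mem_singleton_iff]
    exact ⟨fun h => hF S h.1 T hT v h.2 hv, fun h => h ▸ ⟨hT, hv⟩⟩
  rw [treeAt, this, sSup_singleton]

/-- Since `treeAt` is the supremum of all members containing the vertex, this holds without
disjointness of `F`; hence `Inv` asks for disjointness of the active trees only. -/
theorem vertsOf_paralyze (F : Set G.Subgraph) (T : G.Subgraph) (d : G.Dart)
    (hT : d.fst ∈ T.verts) (hd : d.snd ∈ vertsOf F) :
    vertsOf (insert (T ⊔ treeAt F d.snd ⊔ G.subgraphOfAdj d.adj) (F \ {treeAt F d.snd})) =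
      insert d.snd (vertsOf F ∪ T.verts) := by
  ext w
  simp only [mem_vertsOf] at hd
  obtain ⟨S, hS, hdS⟩ := hd
  rw [vertsOf_insert]
  simp only [SimpleGraph.Subgraph.verts_sup, SimpleGraph.subgraphOfAdj_verts, mem_union,
    mem_verts_treeAt, mem_vertsOf, mem_insert_iff, mem_sdiff, mem_singleton_iff]
  constructor
  · rintro (((h | ⟨T', h1, h2, h3⟩) | h | h) | ⟨T', h1, h2⟩)
    · exact Or.inr (Or.inr h)
    · exact Or.inr (Or.inl ⟨T', h1, h3⟩)
    · exact Or.inr (Or.inr (h ▸ hT))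
    · exact Or.inl h
    · exact Or.inr (Or.inl ⟨T', h1.1, h2⟩)
  · rintro (h | ⟨T', h1, h2⟩ | h)
    · exact Or.inl (Or.inr (Or.inr h))
    · by_cases hT' : T' = treeAt F d.snd
      · left; left; right
        rw [hT', mem_verts_treeAt] at h2
        exact h2
      · exact Or.inr ⟨T', ⟨h1, hT'⟩, h2⟩
    · exact Or.inl (Or.inl (Or.inl h))

theorem vertsOf_diff_singleton_union {F : Set G.Subgraph} {T : G.Subgraph} (hT : T ∈ F) :
    vertsOf (F \ {T}) ∪ T.verts = vertsOf F := by
  rw [union_comm, ← vertsOf_insert, insert_sdiff_singleton, insert_eq_of_mem hT]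

/-- The vertices known to the algorithm: those in a tree and those seen as white vertices. -/
def State.region (s : State G) : Set V := vertsOf s.active ∪ vertsOf s.paral ∪ s.seen

/-- The vertices in the trees of the algorithm. -/
def State.treeVerts (s : State G) : Set V := vertsOf s.active ∪ vertsOf s.paral

theorem State.fresh_iff {s : State G} {y : V} : s.Fresh y ↔ y ∉ s.region := by
  simp [State.Fresh, State.region, not_or, and_assoc]

end

section

/-! ### The invariant of the algorithm -/

/-- The structural properties kept by the algorithm when `x` is initially green and the white
clusters are finite. -/
structure Inv (D : ℕ) (x : V) (c : V → Colour) (s : State G) : Prop where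
  disj : ∀ T ∈ s.active, ∀ T' ∈ s.active, ∀ v, v ∈ T.verts → v ∈ T'.verts → T = T'
  active_fin : s.active.Finite
  fin : s.region.Finite
  -- With the next field: white vertices enter the region only as whole clusters, so the cluster of
  -- a fresh white vertex is disjoint from the region.
  white_seen : ∀ v ∈ s.region, c v = Colour.white → v ∈ s.seen
  seen_white : ∀ v ∈ s.seen, c v = Colour.white ∧ whiteCluster G c v ⊆ s.seen
  red_active : ∀ v ∈ vertsOf s.active, c v ≠ Colour.red
  cand_active : ∀ e ∈ s.cand, ∃ v ∈ e.1, v ∈ vertsOf s.active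
  -- No edge leaving an active tree is ever lost, so stopping with an active tree would mean that
  -- this tree is closed under adjacency.
  active_cand : ∀ v ∈ vertsOf s.active, ∀ e : G.edgeSet, v ∈ e.1 →
    e ∈ s.cand ∨ ∃ T ∈ s.active, ∀ u ∈ e.1, u ∈ T.verts
  conn : s.region ⊆ cluster G s.region x
  -- The `1` is the initial tree; only exploring a white cluster can raise the left side, and it
  -- then pays with its size.
  count : s.active.ncard + {v ∈ s.region | c v = Colour.red}.ncard ≤
    1 + (D - 1) * {v ∈ s.region | c v = Colour.white}.ncard

/-- No candidate edge has both endpoints in the same active tree. -/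
def State.Cleaned (s : State G) : Prop :=
  ∀ e ∈ s.cand, ¬ ∃ T ∈ s.active, ∀ u ∈ e.1, u ∈ T.verts

/-- In passing from `s` to `s'` no vertex is forgotten, and the size of the region and of the trees
grows faster than the number of active trees. -/
structure Progress (s s' : State G) : Prop where
  region : s.region ⊆ s'.region
  -- The potential `2 * |region| + |treeVerts| - |active|`, written without subtraction, rises in
  -- each round: paralyzing and joining lose an active tree, gluing gains a tree vertex, and a white
  -- exploration gains more region vertices than active trees.
  potential : 2 * s.region.ncard + s.treeVerts.ncard + s'.active.ncard + 1 ≤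
    2 * s'.region.ncard + s'.treeVerts.ncard + s.active.ncard

variable {D : ℕ} {x : V} {c : V → Colour} {s s' : State G}

theorem State.treeVerts_subset_region : s.treeVerts ⊆ s.region := subset_union_left

theorem Inv.treeVerts_fin (h : Inv D x c s) : s.treeVerts.Finite :=
  h.fin.subset State.treeVerts_subset_region

theorem conn_mono {R R' : Set V} {x : V} (h : R ⊆ cluster G R x) (hR : R ⊆ R')
    (h' : ∀ z ∈ R', z ∉ R → z ∈ cluster G R' x) : R' ⊆ cluster G R' x := by
  intro z hz
  by_cases hzR : z ∈ R
  · exact cluster_mono hR x (h hzR)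
  · exact h' z hz hzR

theorem conn_insert {R : Set V} {x v y : V} (h : R ⊆ cluster G R x) (hv : v ∈ R)
    (ha : G.Adj v y) : insert y R ⊆ cluster G (insert y R) x := by
  refine conn_mono h (subset_insert _ _) fun z hz hzR => ?_
  obtain rfl : z = y := hz.resolve_right hzR
  exact mem_cluster_adj (cluster_mono (subset_insert _ _) x (h hv)) ha (mem_insert _ _)

theorem Inv.init (hx : c x = Colour.green) (τ : G.edgeSet → ℝ) :
    Inv D x c (initState τ x) := by
  have hR : (initState τ x).region = {x} := by
    simp [State.region, initState, vertsOf]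
  have ha : vertsOf (initState τ x).active = {x} := by simp [initState, vertsOf]
  constructor
  · rintro T rfl T' rfl v - -
    rfl
  · exact finite_singleton _
  · rw [hR]; exact finite_singleton _
  · rw [hR]
    rintro v rfl hv
    rw [hx] at hv
    cases hv
  · rintro v ⟨⟩
  · rw [ha]
    rintro v rfl
    rw [hx]; simp
  · rw [ha]
    intro e he
    exact ⟨x, he, rfl⟩
  · rw [ha]
    rintro v rfl e he
    exact Or.inl he
  · rw [hR]
    rintro v rfl
    exact mem_cluster_self rfl
  · rw [hR]
    have : {v ∈ ({x} : Set V) | c v = Colour.red} = ∅ := by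
      ext v
      simp only [mem_ofPred_eq, mem_singleton_iff, mem_empty_iff_false, iff_false]
      rintro ⟨rfl, h⟩
      rw [hx] at h
      cases h
    rw [this]
    simp [initState]

theorem Inv.clean (h : Inv D x c s) : Inv D x c s.clean :=
  { h with
    cand_active := fun e he => h.cand_active e he.1
    active_cand := fun v hv e he => by
      rcases h.active_cand v hv e he with h1 | h1
      · by_cases h2 : ∃ T ∈ s.active, ∀ u ∈ e.1, u ∈ T.verts
        · exact Or.inr h2
        · exact Or.inl ⟨h1, h2⟩
      · exact Or.inr h1 }

theorem State.cleaned_clean : s.clean.Cleaned := fun _ he => he.2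

/-- The active tree `T` of `v` is paralyzed through the edge `⟨v, y⟩`. -/
theorem Inv.paralyze (h : Inv D x c s) (hcl : s.Cleaned) {d : G.Dart} {T : G.Subgraph}
    (hT : T ∈ s.active) (hv : d.fst ∈ T.verts)
    (hy : d.snd ∈ vertsOf s.paral ∨ c d.snd = Colour.red)
    (h1 : s'.active = s.active \ {T})
    (h2 : vertsOf s'.paral = insert d.snd (vertsOf s.paral ∪ T.verts))
    (h3 : s'.seen = s.seen)
    (h4 : s'.cand = s.cand \ {e | ∃ u w, e.1 = s(u, w) ∧ u ∈ T.verts ∧ w ∉ vertsOf s.active}) :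
    Inv D x c s' ∧ Progress s s' := by
  have hva : vertsOf s'.active ∪ T.verts = vertsOf s.active := by
    rw [h1, vertsOf_diff_singleton_union hT]
  have hsub : vertsOf s'.active ⊆ vertsOf s.active := hva ▸ subset_union_left
  have hR : s'.region = insert d.snd s.region := by
    simp only [State.region, h2, h3, ← hva]
    ext w
    simp only [mem_union, mem_insert_iff]
    tauto
  have hRs : s.region ⊆ s'.region := hR ▸ subset_insert _ _
  have hsa : s'.active ⊆ s.active := h1 ▸ sdiff_subset
  have hcard : s'.active.ncard + 1 = s.active.ncard := by
    rw [h1]; exact ncard_sdiff_singleton_add_one hT h.active_fin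
  have hfin : s'.region.Finite := hR ▸ h.fin.insert _
  have hvR : d.fst ∈ s.region :=
    Or.inl (Or.inl (mem_vertsOf.2 ⟨T, hT, hv⟩))
  have htree : s.treeVerts ⊆ s'.treeVerts := by
    rw [State.treeVerts, State.treeVerts, h2, ← hva]
    intro w
    simp only [mem_union, mem_insert_iff]
    tauto
  refine ⟨⟨fun S hS S' hS' => h.disj S (hsa hS) S' (hsa hS'), h.active_fin.subset hsa, hfin, ?_,
    ?_, fun v hv => h.red_active v (hsub hv), ?_, ?_, ?_, ?_⟩, hRs, ?_⟩
  · intro v hvR' hvw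
    rw [h3]
    rw [hR] at hvR'
    rcases hvR' with rfl | hvR'
    · rcases hy with hy | hy
      · exact h.white_seen _ (Or.inl (Or.inr hy)) hvw
      · rw [hvw] at hy; cases hy
    · exact h.white_seen v hvR' hvw
  · rw [h3]; exact h.seen_white
  · rintro ⟨e, he⟩ hec
    rw [h4] at hec
    induction e using Sym2.ind with
    | _ a b =>
      have hnot := hec.2
      have hnt := hcl _ hec.1
      -- If a surviving candidate edge has an endpoint in `T`, its other end is active, since
      -- otherwise the edge was removed, and not in `T`, by cleanedness. So that end lies in an
      -- active tree that remains.
      have key : ∀ a b : V, s(a, b) ∈ G.edgeSet →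
          ¬ (∃ S ∈ s.active, a ∈ S.verts ∧ b ∈ S.verts) →
          ¬ (a ∈ T.verts ∧ b ∉ vertsOf s.active) → a ∈ vertsOf s.active →
          a ∈ vertsOf s'.active ∨ b ∈ vertsOf s'.active := by
        intro a b _ hn1 hn2 ha
        rw [← hva] at ha
        rcases ha with ha | ha
        · exact Or.inl ha
        · have hb : b ∈ vertsOf s.active := by
            by_contra hb; exact hn2 ⟨ha, hb⟩
          rw [← hva] at hb
          exact Or.inr (hb.resolve_right fun hb => hn1 ⟨T, hT, ha, hb⟩)
      obtain ⟨v, hve, hva'⟩ := h.cand_active _ hec.1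
      simp only [Sym2.mem_iff] at hve hnt ⊢
      rcases hve with rfl | rfl
      · rcases key v b he (fun ⟨S, hS, k1, k2⟩ => hnt ⟨S, hS, by rintro u (rfl | rfl) <;> assumption⟩)
          (fun hh => hnot ⟨v, b, rfl, hh⟩) hva' with k | k
        · exact ⟨v, Or.inl rfl, k⟩
        · exact ⟨b, Or.inr rfl, k⟩
      · rcases key v a (by rwa [Sym2.eq_swap])
          (fun ⟨S, hS, k1, k2⟩ => hnt ⟨S, hS, by rintro u (rfl | rfl) <;> assumption⟩)
          (fun hh => hnot ⟨v, a, Sym2.eq_swap, hh⟩) hva' with k | k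
        · exact ⟨v, Or.inr rfl, k⟩
        · exact ⟨a, Or.inl rfl, k⟩
  · intro v hv e hve
    obtain ⟨S, hS, hvS⟩ := mem_vertsOf.1 hv
    have hST : S ≠ T := by
      rintro rfl
      rw [h1] at hS
      exact hS.2 rfl
    rcases h.active_cand v (hsub hv) e hve with k | ⟨S', hS', k⟩
    · rw [h4]
      by_cases hn : ∃ u w, e.1 = s(u, w) ∧ u ∈ T.verts ∧ w ∉ vertsOf s.active
      · exfalso
        obtain ⟨u, w, he, hu, hw⟩ := hn
        rw [he, Sym2.mem_iff] at hve
        rcases hve with rfl | rfl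
        · exact hST (h.disj S (hsa hS) T hT v hvS hu)
        · exact hw (hsub hv)
      · exact Or.inl ⟨k, hn⟩
    · right
      refine ⟨S', ?_, k⟩
      rw [h.disj S' hS' S (hsa hS) v (k v hve) hvS]
      exact hS
  · rw [hR]
    exact conn_insert h.conn hvR d.adj
  -- At most one red vertex, `d.snd`, is gained, and exactly one active tree is lost.
  · have hr : {v ∈ s'.region | c v = Colour.red} ⊆
        insert d.snd {v ∈ s.region | c v = Colour.red} := by
      rw [hR]
      rintro v ⟨rfl | hv, hc⟩
      · exact mem_insert _ _
      · exact mem_insert_of_mem _ ⟨hv, hc⟩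
    have hr' := (ncard_le_ncard hr ((h.fin.sep _).insert _)).trans (ncard_insert_le _ _)
    have hw : {v ∈ s.region | c v = Colour.white} ⊆ {v ∈ s'.region | c v = Colour.white} :=
      fun v hv => ⟨hRs hv.1, hv.2⟩
    have hw' := Nat.mul_le_mul_left (D - 1) (ncard_le_ncard hw (hfin.sep _))
    have := h.count
    omega
  · have i1 := ncard_le_ncard hRs hfin
    have i2 := ncard_le_ncard htree (hfin.subset State.treeVerts_subset_region)
    omega

/-- The vertex `y` is glued to the active tree `T` of `v` by the edge `⟨v, y⟩`. -/
theorem Inv.glue (h : Inv D x c s) {d : G.Dart} {T : G.Subgraph}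
    (hT : T ∈ s.active) (hv : d.fst ∈ T.verts)
    (hya : d.snd ∉ vertsOf s.active) (hyp : d.snd ∉ vertsOf s.paral)
    (hyr : c d.snd ≠ Colour.red) (hyw : c d.snd = Colour.white → d.snd ∈ s.seen)
    (h1 : s'.active = insert (T ⊔ G.subgraphOfAdj d.adj) (s.active \ {T}))
    (h2 : s'.paral = s.paral) (h3 : s'.seen = s.seen)
    (h4 : s'.cand = s.cand ∪ {e | d.snd ∈ e.1}) :
    Inv D x c s' ∧ Progress s s' := by
  have hTv : (T ⊔ G.subgraphOfAdj d.adj).verts = insert d.snd T.verts := by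
    ext w
    simp only [SimpleGraph.Subgraph.verts_sup, SimpleGraph.subgraphOfAdj_verts, mem_union,
      mem_insert_iff, mem_singleton_iff]
    constructor
    · rintro (k | rfl | k)
      · exact Or.inr k
      · exact Or.inr hv
      · exact Or.inl k
    · rintro (k | k)
      · exact Or.inr (Or.inr k)
      · exact Or.inl k
  have hva : vertsOf s'.active = insert d.snd (vertsOf s.active) := by
    rw [h1, vertsOf_insert, hTv, ← vertsOf_diff_singleton_union hT, insert_union, union_comm]
  have hR : s'.region = insert d.snd s.region := by
    simp only [State.region, h2, h3, hva, insert_union]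
  have htree : s'.treeVerts = insert d.snd s.treeVerts := by
    simp only [State.treeVerts, h2, hva, insert_union]
  have hRs : s.region ⊆ s'.region := hR ▸ subset_insert _ _
  have hfin : s'.region.Finite := hR ▸ h.fin.insert _
  have hcard : s'.active.ncard ≤ s.active.ncard := by
    rw [h1]
    refine (ncard_insert_le _ _).trans ?_
    rw [ncard_sdiff_singleton_add_one hT h.active_fin]
  have hvR : d.fst ∈ s.region := Or.inl (Or.inl (mem_vertsOf.2 ⟨T, hT, hv⟩))
  have key : ∀ S ∈ s.active, ∀ w, w ∈ insert d.snd T.verts → w ∈ S.verts → S = T := by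
    rintro S hS w (rfl | hw) hwS
    · exact absurd (mem_vertsOf.2 ⟨S, hS, hwS⟩) hya
    · exact h.disj S hS T hT w hwS hw
  refine ⟨⟨?_, ?_, hfin, ?_, h3 ▸ h.seen_white, ?_, ?_, ?_, ?_, ?_⟩, hRs, ?_⟩
  · rw [h1]
    rintro S (rfl | hS) S' (rfl | hS') w hw hw'
    · rfl
    · rw [hTv] at hw
      exact absurd (key S' hS'.1 w hw hw') hS'.2
    · rw [hTv] at hw'
      exact absurd (key S hS.1 w hw' hw) hS.2
    · exact h.disj S hS.1 S' hS'.1 w hw hw'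
  · rw [h1]; exact (h.active_fin.sdiff).insert _
  · intro v hvR' hvw
    rw [h3]
    rw [hR] at hvR'
    rcases hvR' with rfl | hvR'
    · exact hyw hvw
    · exact h.white_seen v hvR' hvw
  · rw [hva]
    rintro v (rfl | hv)
    · exact hyr
    · exact h.red_active v hv
  · rw [h4, hva]
    rintro e (he | he)
    · obtain ⟨v, hve, hva⟩ := h.cand_active e he
      exact ⟨v, hve, Or.inr hva⟩
    · exact ⟨d.snd, he, Or.inl rfl⟩
  · rw [hva, h4]
    rintro v (rfl | hv) e hve
    · exact Or.inl (Or.inr hve)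
    · rcases h.active_cand v hv e hve with k | ⟨S, hS, k⟩
      · exact Or.inl (Or.inl k)
      · right
        rw [h1]
        by_cases hST : S = T
        · subst hST
          exact ⟨_, mem_insert _ _, fun u hu => by rw [hTv]; exact Or.inr (k u hu)⟩
        · exact ⟨S, Or.inr ⟨hS, hST⟩, k⟩
  · rw [hR]
    exact conn_insert h.conn hvR d.adj
  · have hr : {v ∈ s'.region | c v = Colour.red} ⊆ {v ∈ s.region | c v = Colour.red} := by
      rw [hR]
      rintro v ⟨rfl | hv, hc⟩
      · exact absurd hc hyr
      · exact ⟨hv, hc⟩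
    have hr' := ncard_le_ncard hr (h.fin.sep _)
    have hw : {v ∈ s.region | c v = Colour.white} ⊆ {v ∈ s'.region | c v = Colour.white} :=
      fun v hv => ⟨hRs hv.1, hv.2⟩
    have hw' := Nat.mul_le_mul_left (D - 1) (ncard_le_ncard hw (hfin.sep _))
    have := h.count
    omega
  · have i1 := ncard_le_ncard hRs hfin
    have i2 : s'.treeVerts.ncard = s.treeVerts.ncard + 1 := by
      rw [htree]
      exact ncard_insert_of_notMem (fun k => k.elim hya hyp) h.treeVerts_fin
    omega

/-- The active trees `T` of `v` and `T'` of `y` are joined by the edge `⟨v, y⟩`. -/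
theorem Inv.join (h : Inv D x c s) {d : G.Dart} {T T' : G.Subgraph}
    (hT : T ∈ s.active) (hv : d.fst ∈ T.verts) (hT' : T' ∈ s.active) (hy : d.snd ∈ T'.verts)
    (hne : T ≠ T')
    (h1 : s'.active = insert (T ⊔ T' ⊔ G.subgraphOfAdj d.adj) (s.active \ {T, T'}))
    (h2 : s'.paral = s.paral) (h3 : s'.seen = s.seen) (h4 : s'.cand = s.cand) :
    Inv D x c s' ∧ Progress s s' := by
  have hTv : (T ⊔ T' ⊔ G.subgraphOfAdj d.adj).verts = T.verts ∪ T'.verts := by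
    ext w
    simp only [SimpleGraph.Subgraph.verts_sup, SimpleGraph.subgraphOfAdj_verts, mem_union,
      mem_insert_iff, mem_singleton_iff]
    constructor
    · rintro (k | rfl | rfl)
      · exact k
      · exact Or.inl hv
      · exact Or.inr hy
    · exact Or.inl
  have hva : vertsOf s'.active = vertsOf s.active := by
    rw [h1, vertsOf_insert, hTv]
    ext w
    simp only [mem_union, mem_vertsOf, mem_sdiff, mem_insert_iff, mem_singleton_iff]
    constructor
    · rintro ((k | k) | ⟨S, k1, k2⟩)
      exacts [⟨T, hT, k⟩, ⟨T', hT', k⟩, ⟨S, k1.1, k2⟩]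
    · rintro ⟨S, k1, k2⟩
      by_cases e1 : S = T
      · exact Or.inl (Or.inl (e1 ▸ k2))
      by_cases e2 : S = T'
      · exact Or.inl (Or.inr (e2 ▸ k2))
      exact Or.inr ⟨S, ⟨k1, not_or.2 ⟨e1, e2⟩⟩, k2⟩
  have hR : s'.region = s.region := by simp only [State.region, h2, h3, hva]
  have htree : s'.treeVerts = s.treeVerts := by simp only [State.treeVerts, h2, hva]
  have hcard : s'.active.ncard + 1 ≤ s.active.ncard := by
    rw [h1]
    have e1 := ncard_insert_le (T ⊔ T' ⊔ G.subgraphOfAdj d.adj) (s.active \ {T, T'})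
    have e2 : (s.active \ {T, T'}).ncard + ({T, T'} : Set G.Subgraph).ncard = s.active.ncard :=
      ncard_sdiff_add_ncard_of_subset (by
        rintro S (rfl | rfl) <;> assumption) h.active_fin
    rw [ncard_pair hne] at e2
    omega
  have key : ∀ S ∈ s.active, ∀ w, w ∈ T.verts ∪ T'.verts → w ∈ S.verts → S = T ∨ S = T' := by
    rintro S hS w (hw | hw) hwS
    · exact Or.inl (h.disj S hS T hT w hwS hw)
    · exact Or.inr (h.disj S hS T' hT' w hwS hw)
  refine ⟨⟨?_, ?_, hR ▸ h.fin, ?_, h3 ▸ h.seen_white, ?_, ?_, ?_, ?_, ?_⟩, hR.ge, ?_⟩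
  · rw [h1]
    rintro S (rfl | hS) S' (rfl | hS') w hw hw'
    · rfl
    · rw [hTv] at hw
      exact absurd (key S' hS'.1 w hw hw') hS'.2
    · rw [hTv] at hw'
      exact absurd (key S hS.1 w hw' hw) hS.2
    · exact h.disj S hS.1 S' hS'.1 w hw hw'
  · rw [h1]; exact (h.active_fin.sdiff).insert _
  · rw [hR, h3]; exact h.white_seen
  · rw [hva]; exact h.red_active
  · rw [hva, h4]; exact h.cand_active
  · rw [hva, h4]
    intro v hv e hve
    rcases h.active_cand v hv e hve with k | ⟨S, hS, k⟩
    · exact Or.inl k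
    · right
      rw [h1]
      by_cases e1 : S = T
      · subst e1
        exact ⟨_, mem_insert _ _, fun u hu => by rw [hTv]; exact Or.inl (k u hu)⟩
      by_cases e2 : S = T'
      · subst e2
        exact ⟨_, mem_insert _ _, fun u hu => by rw [hTv]; exact Or.inr (k u hu)⟩
      exact ⟨S, Or.inr ⟨hS, not_or.2 ⟨e1, e2⟩⟩, k⟩
  · rw [hR]; exact h.conn
  · rw [hR]
    have := h.count
    omega
  · rw [hR, htree]
    omega

/-- The white cluster of the vertex `y` of the edge `⟨v, y⟩` is explored. -/
theorem Inv.freshWhite (h : Inv D x c s)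
    (hdeg : ∀ v, (G.neighborSet v).Finite ∧ (G.neighborSet v).ncard ≤ D)
    (hc : ∀ v, (whiteCluster G c v).Finite) {v y : V} (hv : v ∈ vertsOf s.active)
    (hvy : G.Adj v y) (hy : y ∉ s.region) (hyw : c y = Colour.white) {Zg Zr : Set V}
    (hZg : Zg = {z ∈ vertexBoundary G (whiteCluster G c y) |
      c z = Colour.green ∧ z ∉ vertsOf s.active ∧ z ∉ vertsOf s.paral})
    (hZr : Zr = {z ∈ vertexBoundary G (whiteCluster G c y) |
      c z = Colour.red ∧ z ∉ vertsOf s.paral})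
    (h1 : s'.active = s.active ∪ (fun z => G.singletonSubgraph z) '' Zg)
    (h2 : s'.paral = s.paral ∪ (fun z => G.singletonSubgraph z) '' Zr)
    (h3 : s'.seen = s.seen ∪ whiteCluster G c y)
    (h4 : s'.cand = s.cand ∪ {e | ∃ z ∈ Zg, z ∈ e.1}) :
    Inv D x c s' ∧ Progress s s' := by
  set W := whiteCluster G c y with hW
  have hyW : y ∈ W := mem_cluster_self hyw
  have hva : vertsOf s'.active = vertsOf s.active ∪ Zg := by
    rw [h1, vertsOf_union, vertsOf_singletons]
  have hvp : vertsOf s'.paral = vertsOf s.paral ∪ Zr := by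
    rw [h2, vertsOf_union, vertsOf_singletons]
  have hR : s'.region = s.region ∪ (W ∪ (Zg ∪ Zr)) := by
    simp only [State.region, hva, hvp, h3]
    ext w
    simp only [mem_union]
    tauto
  have hRs : s.region ⊆ s'.region := hR ▸ subset_union_left
  -- A vertex of `W` in the region would have been seen together with its whole cluster, including
  -- the fresh `y`.
  have hWR : ∀ w ∈ W, w ∉ s.region := by
    intro w hw hwR
    have hws := h.white_seen w hwR (white_of_mem_whiteCluster hw)
    have := (h.seen_white w hws).2
    rw [whiteCluster_eq_of_mem hw] at this
    exact hy (Or.inr (this hyW))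
  have hgg : ∀ z ∈ Zg, c z = Colour.green := by rw [hZg]; exact fun z hz => hz.2.1
  have hrr : ∀ z ∈ Zr, c z = Colour.red := by rw [hZr]; exact fun z hz => hz.2.1
  have hgR : ∀ z ∈ Zg, z ∉ s.region := by
    intro z hz hzR
    have hz2 := hz
    rw [hZg] at hz2
    rcases hzR with (k | k) | k
    · exact hz2.2.2.1 k
    · exact hz2.2.2.2 k
    · have := (h.seen_white z k).1
      rw [hgg z hz] at this
      cases this
  -- The vertex `v` from which `y` is reached is active, so it is neither a new green vertex nor
  -- red: it is the neighbour of the root left out in `ncard_boundary_le`.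
  have hvg : v ∉ Zg := fun k => hgR v k (Or.inl (Or.inl hv))
  have hvr : v ∉ Zr := fun k => h.red_active v hv (hrr v k)
  obtain ⟨hZf, hZc⟩ := ncard_boundary_le (Z := Zg ∪ Zr) (y := y) (v := v) hdeg (hc y) hvy (by
    rintro z (k | k)
    · rw [hZg] at k; exact k.1
    · rw [hZr] at k; exact k.1) (fun k => k.elim hvg hvr)
  change _ ≤ (D - 1) * W.ncard at hZc
  have hgf : Zg.Finite := hZf.subset subset_union_left
  have hrf : Zr.Finite := hZf.subset subset_union_right
  have hdisj : Disjoint Zg Zr := by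
    rw [Set.disjoint_left]
    intro z k1 k2
    have := hrr z k2
    rw [hgg z k1] at this
    cases this
  rw [ncard_union_eq hdisj hgf hrf] at hZc
  have hfin : s'.region.Finite := hR ▸ h.fin.union ((hc y).union hZf)
  have hcard : s'.active.ncard ≤ s.active.ncard + Zg.ncard := by
    rw [h1]
    exact (ncard_union_le _ _).trans (Nat.add_le_add_left (ncard_image_le hgf) _)
  have htree : s.treeVerts ⊆ s'.treeVerts := by
    rw [State.treeVerts, State.treeVerts, hva, hvp]
    exact union_subset_union subset_union_left subset_union_left
  have hWs : W ⊆ s'.region := by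
    rw [hR]; exact fun w hw => Or.inr (Or.inl hw)
  refine ⟨⟨?_, ?_, hfin, ?_, ?_, ?_, ?_, ?_, ?_, ?_⟩, hRs, ?_⟩
  · have key : ∀ S ∈ s.active, ∀ z ∈ Zg, ∀ w ∈ S.verts,
        w ∉ (G.singletonSubgraph z).verts := by
      intro S hS z hz w hw hwz
      simp only [SimpleGraph.singletonSubgraph_verts, mem_singleton_iff] at hwz
      subst hwz
      exact hgR w hz (Or.inl (Or.inl (mem_vertsOf.2 ⟨S, hS, hw⟩)))
    rw [h1]
    rintro S (hS | ⟨z, hz, rfl⟩) S' (hS' | ⟨z', hz', rfl⟩) w hw hw'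
    · exact h.disj S hS S' hS' w hw hw'
    · exact absurd hw' (key S hS z' hz' w hw)
    · exact absurd hw (key S' hS' z hz w hw')
    · simp only [SimpleGraph.singletonSubgraph_verts, mem_singleton_iff] at hw hw'
      simp only [← hw, ← hw']
  · rw [h1]; exact h.active_fin.union (hgf.image _)
  · intro w hw hww
    rw [h3]
    rw [hR] at hw
    rcases hw with k | k | k | k
    · exact Or.inl (h.white_seen w k hww)
    · exact Or.inr k
    · rw [hgg w k] at hww; cases hww
    · rw [hrr w k] at hww; cases hww
  · rw [h3]
    rintro w (k | k)
    · exact ⟨(h.seen_white w k).1, (h.seen_white w k).2.trans subset_union_left⟩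
    · exact ⟨white_of_mem_whiteCluster k, by
        rw [whiteCluster_eq_of_mem k]; exact subset_union_right⟩
  · rw [hva]
    rintro w (k | k)
    · exact h.red_active w k
    · rw [hgg w k]; simp
  · rw [hva, h4]
    rintro e (k | ⟨z, hz, hze⟩)
    · obtain ⟨w, hwe, hwa⟩ := h.cand_active e k
      exact ⟨w, hwe, Or.inl hwa⟩
    · exact ⟨z, hze, Or.inr hz⟩
  · rw [hva, h4, h1]
    rintro w (k | k) e hwe
    · rcases h.active_cand w k e hwe with k | ⟨S, hS, k⟩
      · exact Or.inl (Or.inl k)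
      · exact Or.inr ⟨S, Or.inl hS, k⟩
    · exact Or.inl (Or.inr ⟨w, k, hwe⟩)
  · refine conn_mono h.conn hRs fun z hz hzR => ?_
    have hy' : y ∈ cluster G s'.region x :=
      mem_cluster_adj (cluster_mono hRs x (h.conn (Or.inl (Or.inl hv)))) hvy (hWs hyW)
    have hW' : ∀ w ∈ W, w ∈ cluster G s'.region x := fun w hw =>
      mem_cluster_trans hy' (cluster_mono hWs y (mem_cluster_cluster hw))
    have hB : ∀ z ∈ s'.region, z ∈ vertexBoundary G W → z ∈ cluster G s'.region x := by
      rintro z hz ⟨-, w, hw, ha⟩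
      exact mem_cluster_adj (hW' w hw) ha hz
    have hz0 := hz
    rw [hR] at hz
    rcases hz with k | k | k | k
    · exact absurd k hzR
    · exact hW' z k
    · rw [hZg] at k; exact hB z hz0 k.1
    · rw [hZr] at k; exact hB z hz0 k.1
  · have hr : {v ∈ s'.region | c v = Colour.red} ⊆ {v ∈ s.region | c v = Colour.red} ∪ Zr := by
      rw [hR]
      rintro w ⟨k | k | k | k, hcw⟩
      · exact Or.inl ⟨k, hcw⟩
      · rw [white_of_mem_whiteCluster k] at hcw; cases hcw
      · rw [hgg w k] at hcw; cases hcw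
      · exact Or.inr k
    have hr' := (ncard_le_ncard hr ((h.fin.sep _).union hrf)).trans (ncard_union_le _ _)
    have hw : {v ∈ s.region | c v = Colour.white} ∪ W ⊆ {v ∈ s'.region | c v = Colour.white} := by
      rintro w (k | k)
      · exact ⟨hRs k.1, k.2⟩
      · exact ⟨hWs k, white_of_mem_whiteCluster k⟩
    have hd : Disjoint {v ∈ s.region | c v = Colour.white} W := by
      rw [Set.disjoint_left]
      exact fun w k1 k2 => hWR w k2 k1.1
    have hw' := ncard_le_ncard hw (hfin.sep _)
    rw [ncard_union_eq hd (h.fin.sep _) (hc y)] at hw'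
    have hw2 := Nat.mul_le_mul_left (D - 1) hw'
    rw [Nat.mul_add] at hw2
    have := h.count
    omega
  -- Besides the roots `Zg` of the new active trees, the region gains `y`; this extra vertex makes
  -- the potential rise.
  · have i1 : (s.region ∪ insert y Zg).ncard ≤ s'.region.ncard := by
      refine ncard_le_ncard ?_ hfin
      rw [hR]
      rintro w (k | rfl | k)
      · exact Or.inl k
      · exact Or.inr (Or.inl hyW)
      · exact Or.inr (Or.inr (Or.inl k))
    rw [ncard_union_eq (by
        rw [Set.disjoint_left]
        rintro w k (rfl | k')
        · exact hy k
        · exact hgR w k' k) h.fin (hgf.insert _),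
      ncard_insert_of_notMem (fun k => by
        have := hgg y k
        rw [hyw] at this
        cases this) hgf] at i1
    have i2 := ncard_le_ncard htree (hfin.subset State.treeVerts_subset_region)
    omega

end

section

/-! ### Rounds of the algorithm -/

variable {D : ℕ} {x : V} {c : V → Colour} {τ : G.edgeSet → ℝ} {s : State G} {enc : G.Dart → ℕ}

/-- Six cases reduce to four transitions: a fresh red `y` is first made a singleton paralyzing tree
and then treated like a paralyzed one, and a fresh green `y` and a seen white `y` are both glued. -/
theorem Inv.act (h : Inv D x c s) (hcl : s.Cleaned)
    (hdeg : ∀ v, (G.neighborSet v).Finite ∧ (G.neighborSet v).ncard ≤ D)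
    (hc : ∀ v, (whiteCluster G c v).Finite) {d : G.Dart} (hd : Selected enc s d) :
    Inv D x c (act (c, τ) s d) ∧ Progress s (act (c, τ) s d) := by
  obtain ⟨T, hT, hv⟩ := mem_vertsOf.1 hd.1.2
  have hTe : treeAt s.active d.fst = T := treeAt_eq h.disj hT hv
  unfold ParalyzingGrowth.act
  simp only
  split_ifs with hf hp ha
  · rw [State.fresh_iff] at hf
    have hya : d.snd ∉ vertsOf s.active := fun k => hf (Or.inl (Or.inl k))
    have hyp : d.snd ∉ vertsOf s.paral := fun k => hf (Or.inl (Or.inr k))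
    split
    · rename_i hy
      refine h.paralyze hcl hT hv (Or.inr hy) ?_ ?_ rfl ?_
      · change s.active \ {treeAt s.active d.fst} = _
        rw [hTe]
      · change vertsOf (insert (treeAt s.active d.fst ⊔
          treeAt (insert (G.singletonSubgraph d.snd) s.paral) d.snd ⊔ G.subgraphOfAdj d.adj) _) = _
        rw [hTe]
        refine (vertsOf_paralyze _ T d hv ?_).trans ?_
        · rw [vertsOf_insert]
          exact Or.inl (by simp)
        · rw [vertsOf_insert]
          ext w
          simp only [SimpleGraph.singletonSubgraph_verts, mem_insert_iff, mem_union,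
            mem_singleton_iff]
          tauto
      · change s.cand \ {e | ∃ u w, e.1 = s(u, w) ∧ u ∈ (treeAt s.active d.fst).verts ∧ _} = _
        rw [hTe]
        rfl
    · rename_i hy
      refine h.glue hT hv hya hyp (by simp [hy]) (by simp [hy]) ?_ rfl rfl ?_
      · change insert (treeAt s.active d.fst ⊔ _) (s.active \ {treeAt s.active d.fst}) = _
        rw [hTe]
      · change s.cand ∪ {e | ∃ z ∈ ({d.snd} : Set V), z ∈ e.1} = _
        simp
    · rename_i hy
      exact h.freshWhite hdeg hc hd.1.2 d.adj hf hy rfl rfl rfl rfl rfl rfl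
  · refine h.paralyze hcl hT hv (Or.inl hp) ?_ ?_ rfl ?_
    · change s.active \ {treeAt s.active d.fst} = _
      rw [hTe]
    · change vertsOf (insert (treeAt s.active d.fst ⊔
          treeAt s.paral d.snd ⊔ G.subgraphOfAdj d.adj) _) = _
      rw [hTe]
      exact vertsOf_paralyze _ T d hv hp
    · change s.cand \ {e | ∃ u w, e.1 = s(u, w) ∧ u ∈ (treeAt s.active d.fst).verts ∧ _} = _
      rw [hTe]
      rfl
  · obtain ⟨T', hT', hy⟩ := mem_vertsOf.1 ha
    have hTe' : treeAt s.active d.snd = T' := treeAt_eq h.disj hT' hy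
    have hne : T ≠ T' := by
      rintro rfl
      refine hcl _ hd.1.1 ⟨T, hT, fun u hu => ?_⟩
      rcases Sym2.mem_iff.1 (show u ∈ s(d.fst, d.snd) from hu) with rfl | rfl <;> assumption
    refine h.join hT hv hT' hy hne ?_ rfl rfl rfl
    change insert (treeAt s.active d.fst ⊔ treeAt s.active d.snd ⊔ _)
      (s.active \ {treeAt s.active d.fst, treeAt s.active d.snd}) = _
    rw [hTe, hTe']
  · have hseen : d.snd ∈ s.seen := by
      by_contra k
      exact hf ⟨ha, hp, k⟩
    refine h.glue hT hv ha hp (by simp [(h.seen_white _ hseen).1]) (fun _ => hseen) ?_ rfl rfl ?_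
    · change insert (treeAt s.active d.fst ⊔ _) (s.active \ {treeAt s.active d.fst}) = _
      rw [hTe]
    · change s.cand ∪ {e | ∃ z ∈ ({d.snd} : Set V), z ∈ e.1} = _
      simp

/-- The region is finite and the graph locally finite, so only finitely many directed candidate
edges compete; a lexicographic minimum of time and enumeration index exists. -/
theorem Inv.exists_selected (h : Inv D x c s) (hdeg : ∀ v, (G.neighborSet v).Finite)
    (hs : s.cand ≠ ∅) : ∃ d, Selected enc s d := by
  set A : Set G.Dart := {d | dartEdge d ∈ s.cand ∧ d.fst ∈ vertsOf s.active} with hA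
  have hAf : A.Finite := by
    have hsub : A ⊆ ⋃ v ∈ s.region, range (G.dartOfNeighborSet v) := by
      intro d hd
      simp only [mem_iUnion]
      exact ⟨d.fst, Or.inl (Or.inl hd.2), ⟨d.snd, d.adj⟩, rfl⟩
    refine (h.fin.biUnion fun v _ => ?_).subset hsub
    have := (hdeg v).to_subtype
    exact finite_range _
  obtain ⟨e, he⟩ := nonempty_iff_ne_empty.2 hs
  have hAn : A.Nonempty := by
    obtain ⟨v, hve, hva⟩ := h.cand_active e he
    obtain ⟨e, hG⟩ := e
    have hot := Sym2.other_spec hve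
    have hadj : G.Adj v (Sym2.Mem.other hve) := by
      rw [← SimpleGraph.mem_edgeSet, hot]; exact hG
    refine ⟨⟨(v, Sym2.Mem.other hve), hadj⟩, ?_, hva⟩
    convert he using 1
    exact Subtype.ext hot
  obtain ⟨d, hd, hmin⟩ := exists_min_image A
    (fun d => toLex (s.tOne (dartEdge d), enc d)) hAf hAn
  refine ⟨d, hd, fun d' h1 h2 => ?_⟩
  have := hmin d' ⟨h1, h2⟩
  rw [Prod.Lex.le_iff] at this
  exact this

theorem Inv.step (h : Inv D x c s)
    (hdeg : ∀ v, (G.neighborSet v).Finite ∧ (G.neighborSet v).ncard ≤ D)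
    (hc : ∀ v, (whiteCluster G c v).Finite) :
    Inv D x c (step enc (c, τ) s) ∧ s.region ⊆ (step enc (c, τ) s).region ∧
      (¬ s.Stopped → Progress s (step enc (c, τ) s)) := by
  unfold ParalyzingGrowth.step
  split_ifs with hsel
  · have := h.clean.act (τ := τ) State.cleaned_clean hdeg hc hsel.choose_spec
    exact ⟨this.1, this.2.1, fun _ => ⟨this.2.1, this.2.2⟩⟩
  · refine ⟨h.clean, Subset.rfl, fun hs => absurd ?_ hsel⟩
    exact h.clean.exists_selected (fun v => (hdeg v).1) hs

theorem run_succ (ω : Input G) (x : V) (n : ℕ) :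
    run enc ω x (n + 1) = step enc ω (run enc ω x n) :=
  Function.iterate_succ_apply' _ _ _

theorem Inv.run (hx : c x = Colour.green)
    (hdeg : ∀ v, (G.neighborSet v).Finite ∧ (G.neighborSet v).ncard ≤ D)
    (hc : ∀ v, (whiteCluster G c v).Finite) (n : ℕ) : Inv D x c (run enc (c, τ) x n) := by
  induction n with
  | zero => exact Inv.init hx τ
  | succ n ih =>
    rw [run_succ]
    exact (ih.step hdeg hc).1

theorem region_run_mono (hx : c x = Colour.green)
    (hdeg : ∀ v, (G.neighborSet v).Finite ∧ (G.neighborSet v).ncard ≤ D)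
    (hc : ∀ v, (whiteCluster G c v).Finite) :
    Monotone fun n => (run enc (c, τ) x n).region := by
  refine monotone_nat_of_le_succ fun n => ?_
  simp only [run_succ]
  exact ((Inv.run hx hdeg hc n).step hdeg hc).2.1

/-- Sum the increments of the potential over `n` rounds; `3` comes from `2 * |region| + |treeVerts|
≤ 3 * |region|`. -/
theorem le_ncard_region_of_not_stops (hx : c x = Colour.green)
    (hdeg : ∀ v, (G.neighborSet v).Finite ∧ (G.neighborSet v).ncard ≤ D)
    (hc : ∀ v, (whiteCluster G c v).Finite) (hs : ¬ Stops enc (c, τ) x) (n : ℕ) :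
    n ≤ 3 * (run enc (c, τ) x n).region.ncard := by
  have key : n + (run enc (c, τ) x n).active.ncard ≤
      2 * (run enc (c, τ) x n).region.ncard + (run enc (c, τ) x n).treeVerts.ncard := by
    induction n with
    | zero =>
      have h1 : (run enc (c, τ) x 0).treeVerts = {x} := by
        simp [run, initState, State.treeVerts, vertsOf]
      have h2 : (run enc (c, τ) x 0).active.ncard = 1 := by simp [run, initState]
      rw [h1, h2, ncard_singleton]
      omega
    | succ n ih =>
      have := (((Inv.run (enc := enc) (τ := τ) hx hdeg hc n).step (enc := enc) (τ := τ)
        hdeg hc).2.2 fun h => hs ⟨n, h⟩).2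
      rw [← run_succ] at this
      omega
  have := ncard_le_ncard (State.treeVerts_subset_region (s := run enc (c, τ) x n))
    (Inv.run hx hdeg hc n).fin
  omega

/-- With no candidate edge left, an active tree contains all neighbours of its vertices, hence all
of the connected graph; but the region is finite. -/
theorem Inv.vertsOf_active_eq_empty [Infinite V] (h : Inv D x c s) (hG : G.Connected)
    (hs : s.Stopped) : vertsOf s.active = ∅ := by
  rw [eq_empty_iff_forall_notMem]
  intro v hv
  obtain ⟨T, hT, hvT⟩ := mem_vertsOf.1 hv
  have hall : ∀ u, u ∈ T.verts := by
    intro u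
    obtain ⟨p⟩ := hG.preconnected v u
    refine mem_of_walk (A := univ) (fun a ha b _ hab => ?_) p (fun _ _ => mem_univ _) hvT
    rcases h.clean.active_cand a (mem_vertsOf.2 ⟨T, hT, ha⟩) ⟨s(a, b), hab⟩ (by simp) with k | k
    · rw [hs] at k
      exact k.elim
    · obtain ⟨S, hS, k⟩ := k
      rw [h.disj T hT S hS a ha (k a (by simp))]
      exact k b (by simp)
  refine infinite_univ (h.fin.subset fun u _ => ?_)
  exact Or.inl (Or.inl (mem_vertsOf.2 ⟨T, hT, hall u⟩))

theorem outputGraph_of_stops [Infinite V] (hG : G.Connected) (hx : c x = Colour.green)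
    (hdeg : ∀ v, (G.neighborSet v).Finite ∧ (G.neighborSet v).ncard ≤ D)
    (hc : ∀ v, (whiteCluster G c v).Finite) (hs : Stops enc (c, τ) x) :
    ∃ n, outputGraph enc (c, τ) x =
      (⊤ : G.Subgraph).induce (run enc (c, τ) x n).region := by
  refine ⟨Nat.find hs, ?_⟩
  rw [outputGraph, dif_pos hs, State.region,
    (Inv.run hx hdeg hc _).vertsOf_active_eq_empty hG (Nat.find_spec hs), empty_union]

/-! ### The region determines the run -/

theorem snd_mem_region_act {ω : Input G} {d : G.Dart} (hf : s.Fresh d.snd) :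
    d.snd ∈ (act ω s d).region := by
  unfold act
  simp only
  rw [if_pos hf]
  split
  · exact Or.inl (Or.inr (mem_vertsOf.2 ⟨_, mem_insert _ _, Or.inr (by simp)⟩))
  · exact Or.inl (Or.inl (mem_vertsOf.2 ⟨_, mem_insert _ _, Or.inr (by simp)⟩))
  · rename_i h
    exact Or.inr (Or.inr (mem_cluster_self h))

/-- A round reads the colours of a fresh `y`, of its white cluster with boundary, or of vertices of
paralyzing trees. All of them lie in the region after the round. -/
theorem act_congr {c' : V → Colour} {d : G.Dart} (hmono : s.region ⊆ (act (c, τ) s d).region)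
    (hcc : ∀ v ∈ (act (c, τ) s d).region, c v = c' v) : act (c, τ) s d = act (c', τ) s d := by
  by_cases hf : s.Fresh d.snd
  · have hy := hcc _ (snd_mem_region_act hf)
    cases hcy : c d.snd with
    | red =>
      have hcy' := hy ▸ hcy
      simp only [act, if_pos hf, hcy, hcy']
    | green =>
      have hcy' := hy ▸ hcy
      simp only [act, if_pos hf, hcy, hcy']
    | white =>
      have hcy' := hy ▸ hcy
      have hact : act (c, τ) s d = actFreshWhite c τ s d.snd := by
        simp only [act, if_pos hf, hcy]
      have hact' : act (c', τ) s d = actFreshWhite c' τ s d.snd := by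
        simp only [act, if_pos hf, hcy']
      rw [hact] at hcc
      rw [hact, hact']
      have hWc : ∀ w ∈ whiteCluster G c d.snd, c w = c' w := fun w hw => hcc w (Or.inr (Or.inr hw))
      -- Boundary vertices are never white, and each green or red one is already in a tree or starts
      -- one now.
      have hBc : ∀ z ∈ vertexBoundary G (whiteCluster G c d.snd), c z = c' z := by
        intro z hz
        apply hcc
        by_cases ha : z ∈ vertsOf s.active
        · left; left
          change z ∈ vertsOf (s.active ∪ _)
          rw [vertsOf_union]
          exact Or.inl ha
        by_cases hp : z ∈ vertsOf s.paral
        · left; right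
          change z ∈ vertsOf (s.paral ∪ _)
          rw [vertsOf_union]
          exact Or.inl hp
        have hnw := not_white_of_mem_vertexBoundary hz
        cases hcz : c z with
        | white => exact absurd hcz hnw
        | green =>
          left; left
          change z ∈ vertsOf (s.active ∪ _)
          rw [vertsOf_union, vertsOf_singletons]
          exact Or.inr ⟨hz, hcz, ha, hp⟩
        | red =>
          left; right
          change z ∈ vertsOf (s.paral ∪ _)
          rw [vertsOf_union, vertsOf_singletons]
          exact Or.inr ⟨hz, hcz, hp⟩
      have hW : whiteCluster G c d.snd = whiteCluster G c' d.snd := by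
        refine cluster_congr hcy fun w hw => ?_
        rcases hw with k | k
        · simp only [mem_ofPred_eq, hWc w k]
        · simp only [mem_ofPred_eq, hBc w k]
      have hZg : {z ∈ vertexBoundary G (whiteCluster G c' d.snd) |
          c z = Colour.green ∧ z ∉ vertsOf s.active ∧ z ∉ vertsOf s.paral} =
          {z ∈ vertexBoundary G (whiteCluster G c' d.snd) |
          c' z = Colour.green ∧ z ∉ vertsOf s.active ∧ z ∉ vertsOf s.paral} := by
        rw [← hW]
        ext z
        exact and_congr_right fun hz => by rw [hBc z hz]
      have hZr : {z ∈ vertexBoundary G (whiteCluster G c' d.snd) |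
          c z = Colour.red ∧ z ∉ vertsOf s.paral} =
          {z ∈ vertexBoundary G (whiteCluster G c' d.snd) |
          c' z = Colour.red ∧ z ∉ vertsOf s.paral} := by
        rw [← hW]
        ext z
        exact and_congr_right fun hz => by rw [hBc z hz]
      simp only [actFreshWhite, hZg, hZr, hW]
  · by_cases hp : d.snd ∈ vertsOf s.paral
    · simp only [act, if_neg hf, if_pos hp]
    by_cases ha : d.snd ∈ vertsOf s.active
    · simp only [act, if_neg hf, if_neg hp, if_pos ha]
    simp only [act, if_neg hf, if_neg hp, if_neg ha, actSeenWhite]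
    congr 2
    funext e
    split_ifs with h1 h2 h3 h3
    · rfl
    · exact absurd ⟨h2.1, (hcc _ (hmono (Or.inl (Or.inr h2.1)))) ▸ h2.2⟩ h3
    · exact absurd ⟨h3.1, (hcc _ (hmono (Or.inl (Or.inr h3.1)))) ▸ h3.2⟩ h2
    · rfl
    · rfl

theorem step_congr {c' : V → Colour} (h : Inv D x c s)
    (hdeg : ∀ v, (G.neighborSet v).Finite ∧ (G.neighborSet v).ncard ≤ D)
    (hc : ∀ v, (whiteCluster G c v).Finite)
    (hcc : ∀ v ∈ (step enc (c, τ) s).region, c v = c' v) :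
    step enc (c, τ) s = step enc (c', τ) s := by
  unfold step at hcc ⊢
  split_ifs with hsel
  · rw [dif_pos hsel] at hcc
    exact act_congr (h.clean.act State.cleaned_clean hdeg hc hsel.choose_spec).2.1 hcc
  · rfl

/-- The run up to round `n` only depends on the colours in the region after round `n`. -/
theorem run_congr {c' : V → Colour} (hx : c x = Colour.green)
    (hdeg : ∀ v, (G.neighborSet v).Finite ∧ (G.neighborSet v).ncard ≤ D)
    (hc : ∀ v, (whiteCluster G c v).Finite) (n : ℕ)
    (hcc : ∀ v ∈ (run enc (c, τ) x n).region, c v = c' v) :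
    run enc (c, τ) x n = run enc (c', τ) x n := by
  induction n with
  | zero => rfl
  | succ n ih =>
    have := ih fun v hv => hcc v (region_run_mono hx hdeg hc (Nat.le_succ n) hv)
    rw [run_succ, run_succ, ← this]
    rw [run_succ] at hcc
    exact step_congr (Inv.run hx hdeg hc n) hdeg hc hcc

/-! ### Size and diameter of the output -/

theorem exists_walk_induce {R : Set V} {u v : V} (p : G.Walk u v) (hp : ∀ w ∈ p.support, w ∈ R)
    (hu : u ∈ ((⊤ : G.Subgraph).induce R).verts) (hv : v ∈ ((⊤ : G.Subgraph).induce R).verts) :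
    ((⊤ : G.Subgraph).induce R).coe.Reachable ⟨u, hu⟩ ⟨v, hv⟩ := by
  induction p with
  | nil => exact SimpleGraph.Reachable.refl _
  | @cons a b _ h p ih =>
    simp only [SimpleGraph.Walk.support_cons, List.mem_cons, forall_eq_or_imp] at hp
    have hb : b ∈ R := hp.2 _ p.start_mem_support
    refine SimpleGraph.Reachable.trans (SimpleGraph.Adj.reachable ?_) (ih hp.2 hb hv)
    simp only [SimpleGraph.Subgraph.coe_adj, SimpleGraph.Subgraph.induce_adj,
      SimpleGraph.Subgraph.top_adj]
    exact ⟨hp.1, hb, h⟩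

/-- A path in the induced graph has fewer edges than the graph has vertices. -/
theorem edist_induce_le {R : Set V} (hR : R.Finite) (hconn : R ⊆ cluster G R x)
    (u v : ((⊤ : G.Subgraph).induce R).verts) :
    ((⊤ : G.Subgraph).induce R).coe.edist u v ≤ R.encard := by
  have hu : u.1 ∈ R := u.2
  have hv : v.1 ∈ R := v.2
  obtain ⟨p, hp⟩ := mem_cluster_trans (mem_cluster_symm (hconn hu)) (hconn hv)
  obtain ⟨q⟩ := exists_walk_induce p hp hu hv
  have : Fintype ((⊤ : G.Subgraph).induce R).verts := hR.fintype
  have hq := (q.toPath.2.length_lt).le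
  refine (SimpleGraph.edist_le q.toPath.1).trans ?_
  have hcard : (Fintype.card ((⊤ : G.Subgraph).induce R).verts : ℕ∞) = R.encard := by
    have := Set.coe_fintypeCard ((⊤ : G.Subgraph).induce R).verts
    simpa using this
  rw [← hcard]
  exact_mod_cast hq

theorem edist_le_edist_coe (H : G.Subgraph) (u v : H.verts) :
    G.edist u v ≤ H.coe.edist u v := by
  by_cases h : H.coe.edist u v = ⊤
  · rw [h]; exact le_top
  · obtain ⟨p, hp⟩ := (SimpleGraph.edist_ne_top_iff_reachable.1 h).exists_walk_length_eq_edist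
    rw [← hp, ← SimpleGraph.Walk.length_map H.hom p]
    exact SimpleGraph.edist_le _

/-- Size and diameters of the output are bounded by the sizes of the regions. -/
theorem exists_le_region [Infinite V] (hG : G.Connected) (hx : c x = Colour.green)
    (hdeg : ∀ v, (G.neighborSet v).Finite ∧ (G.neighborSet v).ncard ≤ D)
    (hc : ∀ v, (whiteCluster G c v).Finite) {n : ℕ}
    (hn : ¬ Stops enc (c, τ) x ∨ (n : ℕ∞) ≤ (outputGraph enc (c, τ) x).verts.encard ∨
      (n : ℕ∞) ≤ (outputGraph enc (c, τ) x).coe.ediam ∨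
      (n : ℕ∞) ≤ setDiam G (outputGraph enc (c, τ) x).verts) :
    ∃ k, n ≤ (run enc (c, τ) x k).region.ncard := by
  by_cases hs : Stops enc (c, τ) x
  · obtain ⟨k, hk⟩ := outputGraph_of_stops hG hx hdeg hc hs
    refine ⟨k, ?_⟩
    have hinv := Inv.run (enc := enc) (τ := τ) hx hdeg hc k
    have hed := edist_induce_le hinv.fin hinv.conn
    rw [hk] at hn
    have : (n : ℕ∞) ≤ (run enc (c, τ) x k).region.encard := by
      rcases hn with h | h | h | h
      · exact absurd hs h
      · simpa using h
      · exact h.trans (SimpleGraph.ediam_le_of_edist_le hed)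
      · refine h.trans (iSup₂_le fun u hu => iSup₂_le fun v hv => ?_)
        exact (edist_le_edist_coe _ ⟨u, hu⟩ ⟨v, hv⟩).trans (hed ⟨u, hu⟩ ⟨v, hv⟩)
    rw [← hinv.fin.cast_ncard_eq] at this
    exact_mod_cast this
  · refine ⟨3 * n, ?_⟩
    have := le_ncard_region_of_not_stops hx hdeg hc hs (3 * n)
    omega

end

section

/-! ### Measurability of the run in the opening times -/

/-- A random state with constant combinatorial part and measurable times. -/
def MeasState (g : (G.edgeSet → ℝ) → State G) : Prop :=
  ∃ (A P : Set G.Subgraph) (S : Set V) (C : Set G.edgeSet)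
    (f₁ f₂ : (G.edgeSet → ℝ) → G.edgeSet → ℝ) (f₃ f₄ : (G.edgeSet → ℝ) → V → ℝ),
    (∀ e, Measurable fun τ => f₁ τ e) ∧ (∀ e, Measurable fun τ => f₂ τ e) ∧
    (∀ v, Measurable fun τ => f₃ τ v) ∧ (∀ v, Measurable fun τ => f₄ τ v) ∧
    g = fun τ => ⟨A, P, S, C, f₁ τ, f₂ τ, f₃ τ, f₄ τ⟩

theorem measState_of {g : (G.edgeSet → ℝ) → State G} (ha : ∀ τ, (g τ).active = (g 0).active)
    (hp : ∀ τ, (g τ).paral = (g 0).paral) (hs : ∀ τ, (g τ).seen = (g 0).seen)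
    (hc : ∀ τ, (g τ).cand = (g 0).cand) (h₁ : ∀ e, Measurable fun τ => (g τ).tOne e)
    (h₂ : ∀ e, Measurable fun τ => (g τ).tOpen e) (h₃ : ∀ v, Measurable fun τ => (g τ).tGreen v)
    (h₄ : ∀ v, Measurable fun τ => (g τ).tRed v) : MeasState g :=
  ⟨(g 0).active, (g 0).paral, (g 0).seen, (g 0).cand, fun τ => (g τ).tOne, fun τ => (g τ).tOpen,
    fun τ => (g τ).tGreen, fun τ => (g τ).tRed, h₁, h₂, h₃, h₄,
    funext fun τ => State.ext (ha τ) (hp τ) (hs τ) (hc τ) rfl rfl rfl rfl⟩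

theorem measurable_update_apply {Ω α : Type*} [DecidableEq α] [MeasurableSpace Ω] {f : Ω → α → ℝ} {g : Ω → ℝ}
    (hf : ∀ a, Measurable fun ω => f ω a) (hg : Measurable g) (a b : α) :
    Measurable fun ω => Function.update (f ω) a (g ω) b := by
  by_cases h : b = a
  · subst h; simpa using hg
  · simpa [Function.update_of_ne h] using hf b

variable {g : (G.edgeSet → ℝ) → State G} {x : V} {c : V → Colour} {enc : G.Dart → ℕ}

theorem MeasState.clean (h : MeasState g) : MeasState fun τ => (g τ).clean := by
  obtain ⟨A, P, S, C, f₁, f₂, f₃, f₄, h1, h2, h3, h4, rfl⟩ := h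
  exact measState_of (fun _ => rfl) (fun _ => rfl) (fun _ => rfl) (fun _ => rfl) h1 h2 h3 h4

theorem MeasState.setOpen (h : MeasState g) (e : G.edgeSet) :
    MeasState fun τ => (g τ).setOpen e := by
  obtain ⟨A, P, S, C, f₁, f₂, f₃, f₄, h1, h2, h3, h4, rfl⟩ := h
  refine measState_of (fun _ => rfl) (fun _ => rfl) (fun _ => rfl) (fun _ => rfl) h1
    (fun b => ?_) h3 h4
  dsimp only [State.setOpen]
  exact measurable_update_apply h2 (h1 e) e b

theorem MeasState.addEdges (h : MeasState g) (Z : Set V)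
    {f : (G.edgeSet → ℝ) → G.edgeSet → ℝ} (hf : ∀ e, Measurable fun τ => f τ e) :
    MeasState fun τ => (g τ).addEdges Z (f τ) := by
  obtain ⟨A, P, S, C, f₁, f₂, f₃, f₄, h1, h2, h3, h4, rfl⟩ := h
  refine measState_of (fun _ => rfl) (fun _ => rfl) (fun _ => rfl) (fun _ => rfl)
    (fun e => ?_) h2 h3 h4
  dsimp only [State.addEdges]
  split_ifs
  · exact hf e
  · exact h1 e

theorem MeasState.glueVertex (h : MeasState g) (d : G.Dart) :
    MeasState fun τ => glueVertex (g τ) d := by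
  obtain ⟨A, P, S, C, f₁, f₂, f₃, f₄, h1, h2, h3, h4, rfl⟩ := h
  exact measState_of (fun _ => rfl) (fun _ => rfl) (fun _ => rfl) (fun _ => rfl) h1 h2 h3 h4

theorem MeasState.actJoin (h : MeasState g) (d : G.Dart) :
    MeasState fun τ => actJoin (g τ) d := by
  obtain ⟨A, P, S, C, f₁, f₂, f₃, f₄, h1, h2, h3, h4, rfl⟩ := h
  exact measState_of (fun _ => rfl) (fun _ => rfl) (fun _ => rfl) (fun _ => rfl) h1 h2 h3 h4

theorem MeasState.actParalyze (h : MeasState g) (d : G.Dart) :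
    MeasState fun τ => actParalyze (g τ) d := by
  obtain ⟨A, P, S, C, f₁, f₂, f₃, f₄, h1, h2, h3, h4, rfl⟩ := h
  refine measState_of (fun _ => rfl) (fun _ => rfl) (fun _ => rfl) (fun _ => rfl) h1 h2 h3
    fun v => ?_
  dsimp only [ParalyzingGrowth.actParalyze]
  split_ifs
  · exact h2 _
  · exact h4 v

theorem MeasState.actFreshRed (h : MeasState g) (d : G.Dart) :
    MeasState fun τ => actFreshRed (g τ) d := by
  refine MeasState.actParalyze ?_ d
  obtain ⟨A, P, S, C, f₁, f₂, f₃, f₄, h1, h2, h3, h4, rfl⟩ := h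
  exact measState_of (fun _ => rfl) (fun _ => rfl) (fun _ => rfl) (fun _ => rfl) h1 h2 h3
    (measurable_update_apply h4 measurable_const d.snd)

theorem MeasState.actFreshGreen (h : MeasState g) (d : G.Dart) :
    MeasState fun τ => actFreshGreen τ (g τ) d := by
  refine (MeasState.addEdges ?_ {d.snd} (f := fun τ => τ) measurable_pi_apply).glueVertex d
  obtain ⟨A, P, S, C, f₁, f₂, f₃, f₄, h1, h2, h3, h4, rfl⟩ := h
  exact measState_of (fun _ => rfl) (fun _ => rfl) (fun _ => rfl) (fun _ => rfl) h1 h2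
    (measurable_update_apply h3 measurable_const d.snd) h4

theorem MeasState.actFreshWhite (h : MeasState g) (y : V) :
    MeasState fun τ => actFreshWhite c τ (g τ) y := by
  obtain ⟨A, P, S, C, f₁, f₂, f₃, f₄, h1, h2, h3, h4, rfl⟩ := h
  dsimp only [ParalyzingGrowth.actFreshWhite]
  refine MeasState.addEdges ?_ _ (f := fun τ => τ) measurable_pi_apply
  refine measState_of (fun _ => rfl) (fun _ => rfl) (fun _ => rfl) (fun _ => rfl) h1 h2
    (fun v => ?_) fun v => ?_ <;> dsimp only <;> split_ifs
  exacts [measurable_const, h3 v, measurable_const, h4 v]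

theorem MeasState.actSeenWhite (h : MeasState g) (d : G.Dart) :
    MeasState fun τ => actSeenWhite c τ (g τ) d := by
  obtain ⟨A, P, S, C, f₁, f₂, f₃, f₄, h1, h2, h3, h4, rfl⟩ := h
  dsimp only [ParalyzingGrowth.actSeenWhite]
  refine (MeasState.addEdges ?_ {d.snd} fun e => ?_).glueVertex d
  · exact measState_of (fun _ => rfl) (fun _ => rfl) (fun _ => rfl) (fun _ => rfl) h1 h2
      (measurable_update_apply h3 (h2 _) d.snd) h4
  · by_cases hy : d.snd ∈ e.1
    · simp only [dif_pos hy]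
      have k : Measurable fun τ : G.edgeSet → ℝ => τ e := measurable_pi_apply e
      split_ifs
      · exact ((h2 (dartEdge d)).add k).sub ((h4 _).sub (h3 _))
      · exact (h2 (dartEdge d)).add k
    · simp only [dif_neg hy]
      exact measurable_const

/-- Once the directed edge is fixed, the case distinction depends only on the colours and the
constant combinatorial part; the opening times enter the round only through the choice of that edge.
-/
theorem MeasState.act (h : MeasState g) (d : G.Dart) :
    MeasState fun τ => act (c, τ) (g τ) d := by
  have h0 := h
  obtain ⟨A, P, S, C, f₁, f₂, f₃, f₄, h1, h2, h3, h4, hg⟩ := h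
  have hf : ∀ τ, (g τ).Fresh d.snd ↔ d.snd ∉ vertsOf A ∧ d.snd ∉ vertsOf P ∧ d.snd ∉ S := by
    intro τ; rw [hg]; rfl
  have hp : ∀ τ, vertsOf (g τ).paral = vertsOf P := by
    intro τ; rw [hg]
  have ha : ∀ τ, vertsOf (g τ).active = vertsOf A := by
    intro τ; rw [hg]
  simp only [ParalyzingGrowth.act, hf, hp, ha]
  split_ifs
  · split
    · exact (h0.setOpen _).actFreshRed d
    · exact (h0.setOpen _).actFreshGreen d
    · exact h0.actFreshWhite _
  · exact (h0.setOpen _).actParalyze d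
  · exact (h0.setOpen _).actJoin d
  · exact (h0.setOpen _).actSeenWhite d

theorem countable_dart [Countable V] : Countable G.Dart :=
  Function.Injective.countable (f := SimpleGraph.Dart.toProd)
    SimpleGraph.Dart.toProd_injective

theorem MeasState.measurableSet_selected [Countable V] (h : MeasState g) (d : G.Dart) :
    MeasurableSet {τ | Selected enc (g τ) d} := by
  have := countable_dart (G := G)
  obtain ⟨A, P, S, C, f₁, f₂, f₃, f₄, h1, h2, h3, h4, rfl⟩ := h
  have : {τ | Selected enc (⟨A, P, S, C, f₁ τ, f₂ τ, f₃ τ, f₄ τ⟩ : State G) d} =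
      {_τ | dartEdge d ∈ C ∧ d.fst ∈ vertsOf A} ∩
      ⋂ d' : G.Dart, ⋂ _ : dartEdge d' ∈ C, ⋂ _ : d'.fst ∈ vertsOf A,
        {τ | f₁ τ (dartEdge d) < f₁ τ (dartEdge d')} ∪
          ({τ | f₁ τ (dartEdge d) = f₁ τ (dartEdge d')} ∩ {_τ | enc d ≤ enc d'}) := by
    ext τ
    simp only [Selected, mem_inter_iff, mem_iInter, mem_union, mem_ofPred_eq]
  refine this ▸ (MeasurableSet.const _).inter (MeasurableSet.iInter fun d' =>
    MeasurableSet.iInter fun _ => MeasurableSet.iInter fun _ => ?_)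
  exact (measurableSet_lt (h1 _) (h1 _)).union
    ((measurableSet_eq_fun (h1 _) (h1 _)).inter (MeasurableSet.const _))

/-- A random state which is given by countably many states of the form `MeasState`. -/
def PiecewiseMeasState (f : (G.edgeSet → ℝ) → State G) : Prop :=
  ∃ (ι : Type u) (_ : Countable ι) (B : ι → Set (G.edgeSet → ℝ))
    (g : ι → (G.edgeSet → ℝ) → State G), (∀ i, MeasurableSet (B i)) ∧ (∀ τ, ∃ i, τ ∈ B i) ∧
    (∀ i, MeasState (g i)) ∧ ∀ i, ∀ τ ∈ B i, f τ = g i τ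

/-- Injectivity of `enc` breaks all ties. It makes the arbitrary choice in `step` harmless, so that
a round is determined on each event that a given edge is selected. -/
theorem Selected.unique (henc : Function.Injective enc) {s : State G} {d d' : G.Dart}
    (h : Selected enc s d) (h' : Selected enc s d') : d = d' := by
  have h1 := h.2 d' h'.1.1 h'.1.2
  have h2 := h'.2 d h.1.1 h.1.2
  apply henc
  rcases h1 with h1 | ⟨h1, h1'⟩
  · rcases h2 with h2 | ⟨h2, -⟩
    · exact absurd h1 h2.not_gt
    · exact absurd h2.symm h1.ne
  · rcases h2 with h2 | ⟨h2, h2'⟩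
    · exact absurd h1.symm h2.ne
    · exact le_antisymm h1' h2'

/-- Each piece is split according to the selected directed edge, or the absence of one; there are
countably many possibilities, and each is a measurable event. -/
theorem PiecewiseMeasState.step [Countable V] (henc : Function.Injective enc)
    {f : (G.edgeSet → ℝ) → State G} (h : PiecewiseMeasState f) :
    PiecewiseMeasState fun τ => step enc (c, τ) (f τ) := by
  have := countable_dart (G := G)
  obtain ⟨ι, hι, B, g, hB, hcov, hg, hf⟩ := h
  refine ⟨ι × Option G.Dart, inferInstance, fun p => B p.1 ∩ match p.2 with
    | some d => {τ | Selected enc (g p.1 τ).clean d}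
    | none => {τ | ∀ d, ¬ Selected enc (g p.1 τ).clean d},
    fun p τ => match p.2 with
    | some d => ParalyzingGrowth.act (c, τ) (g p.1 τ).clean d
    | none => (g p.1 τ).clean, ?_, ?_, ?_, ?_⟩
  · rintro ⟨i, _ | d⟩
    · refine (hB i).inter ?_
      simp only [Set.ofPred_forall]
      exact MeasurableSet.iInter fun d => ((hg i).clean.measurableSet_selected d).compl
    · exact (hB i).inter ((hg i).clean.measurableSet_selected d)
  · intro τ
    obtain ⟨i, hi⟩ := hcov τ
    by_cases hs : ∃ d, Selected enc (g i τ).clean d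
    · obtain ⟨d, hd⟩ := hs
      exact ⟨(i, some d), hi, hd⟩
    · exact ⟨(i, none), hi, not_exists.1 hs⟩
  · rintro ⟨i, _ | d⟩
    · exact (hg i).clean
    · exact (hg i).clean.act d
  · rintro ⟨i, _ | d⟩ τ ⟨h1, h2⟩
    · simp only [hf i τ h1, ParalyzingGrowth.step]
      rw [dif_neg (not_exists.2 h2)]
    · simp only [hf i τ h1, ParalyzingGrowth.step]
      have hs : ∃ d, Selected enc (g i τ).clean d := ⟨d, h2⟩
      rw [dif_pos hs, hs.choose_spec.unique henc h2]

theorem piecewiseMeasState_run [Countable V] (henc : Function.Injective enc) (n : ℕ) :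
    PiecewiseMeasState fun τ => run enc (c, τ) x n := by
  induction n with
  | zero =>
    refine ⟨PUnit, inferInstance, fun _ => univ, fun _ τ => initState τ x,
      fun _ => MeasurableSet.univ, fun _ => ⟨⟨⟩, mem_univ _⟩, fun _ => ?_, fun _ _ _ => rfl⟩
    exact measState_of (fun _ => rfl) (fun _ => rfl) (fun _ => rfl) (fun _ => rfl)
      (fun e => by
        dsimp only [initState]
        split_ifs
        exacts [measurable_pi_apply e, measurable_const])
      (fun _ => measurable_const) (fun _ => measurable_const) (fun _ => measurable_const)
  | succ n ih =>
    simp only [run_succ]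
    exact ih.step henc

theorem measurableSet_region_run [Countable V] (henc : Function.Injective enc) (n : ℕ)
    (A : Set V) : MeasurableSet {τ | (run enc (c, τ) x n).region = A} := by
  obtain ⟨ι, hι, B, g, hB, hcov, hg, hf⟩ :=
    piecewiseMeasState_run (x := x) (c := c) henc n
  have : {τ | (run enc (c, τ) x n).region = A} = ⋃ i, B i ∩ {τ | (g i τ).region = A} := by
    ext τ
    simp only [mem_iUnion, mem_inter_iff, mem_ofPred_eq]
    constructor
    · intro h
      obtain ⟨i, hi⟩ := hcov τ
      exact ⟨i, hi, (congrArg State.region (hf i τ hi)).symm.trans h⟩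
    · rintro ⟨i, hi, h⟩
      exact (congrArg State.region (hf i τ hi)).trans h
  rw [this]
  refine MeasurableSet.iUnion fun i => (hB i).inter ?_
  obtain ⟨A', P, S, C, f₁, f₂, f₃, f₄, h1, h2, h3, h4, hgi⟩ := hg i
  generalize g i = gi at hgi
  subst hgi
  exact MeasurableSet.const (vertsOf A' ∪ vertsOf P ∪ S = A)

end

section

/-! ### The colour law and its tilted version -/

instance : Fintype Colour where
  elems := {Colour.white, Colour.green, Colour.red}
  complete := by rintro (_ | _ | _) <;> simp

instance : MeasurableSingletonClass Colour := ⟨fun _ => trivial⟩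

section
variable (pw pg pr : unitInterval)

theorem colourLaw_white : colourLaw pw pg pr {Colour.white} = ENNReal.ofReal pw := by
  simp [colourLaw]

theorem colourLaw_green : colourLaw pw pg pr {Colour.green} = ENNReal.ofReal pg := by
  simp [colourLaw]

theorem colourLaw_red : colourLaw pw pg pr {Colour.red} = ENNReal.ofReal pr := by
  simp [colourLaw]

variable {pw pg pr}

theorem isProbabilityMeasure_colourLaw (h : (pw : ℝ) + pg + pr = 1) :
    IsProbabilityMeasure (colourLaw pw pg pr) := by
  constructor
  simp only [colourLaw, Measure.coe_add, Measure.coe_smul, Pi.add_apply, Pi.smul_apply,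
    measure_univ, smul_eq_mul, mul_one]
  rw [← ENNReal.ofReal_add pw.2.1 pg.2.1, ← ENNReal.ofReal_add (add_nonneg pw.2.1 pg.2.1) pr.2.1,
    h, ENNReal.ofReal_one]

end

/-- The left side equals the right side at `t = 1` and has derivative `d * p - r < 0` there, so it
drops just to the right of `1`. -/
theorem exists_tilt (d : ℕ) {p q r : ℝ} (h : d * p < r) :
    ∃ t : ℝ, 1 < t ∧ p * t ^ d + q + r * t⁻¹ < p + q + r := by
  have hd : HasDerivAt (fun t : ℝ => p * t ^ d + q + r * t⁻¹) (p * d - r) 1 := by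
    have := (((hasDerivAt_pow d (1 : ℝ)).const_mul p).add_const q).fun_add
      ((hasDerivAt_inv (one_ne_zero (α := ℝ))).const_mul r)
    refine this.congr_deriv ?_
    simp
    ring
  have h2 := (hd.tendsto_slope.mono_left (nhdsGT_le_nhdsNE 1)).eventually
    (gt_mem_nhds (show p * d - r < 0 by linarith))
  obtain ⟨t, ht, h1⟩ := (h2.and self_mem_nhdsWithin).exists
  refine ⟨t, h1, ?_⟩
  rw [slope_def_field, div_lt_iff₀ (sub_pos.2 h1)] at ht
  simp only [one_pow, inv_one, mul_one, zero_mul] at ht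
  linarith

/-- Tilting: weights `t ^ d`, `1`, `t⁻¹` on the colours have mean `M < 1`; the colour law is
compared with the law having density proportional to these weights. -/
theorem exists_tilted_law {pw pg pr : unitInterval} (hsum : (pw : ℝ) + pg + pr = 1) (d : ℕ)
    (h : d * (pw : ℝ) < pr) :
    ∃ (qw qg qr : unitInterval) (t M : ℝ), (qw : ℝ) + qg + qr = 1 ∧ 1 < t ∧ 0 < M ∧ M < 1 ∧
      (pw : ℝ) * t ^ d = M * qw ∧ (pg : ℝ) = M * qg ∧ (pr : ℝ) = M * t * qr := by
  obtain ⟨t, ht, hM⟩ := exists_tilt (q := pg) d h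
  have ht0 : 0 < t := by linarith
  set M := (pw : ℝ) * t ^ d + pg + pr * t⁻¹ with hMdef
  have hpr : 0 < (pr : ℝ) := lt_of_le_of_lt (mul_nonneg d.cast_nonneg pw.2.1) h
  have a1 : 0 ≤ (pw : ℝ) * t ^ d := mul_nonneg pw.2.1 (pow_nonneg ht0.le _)
  have a2 : 0 ≤ (pg : ℝ) := pg.2.1
  have a3 : 0 < (pr : ℝ) * t⁻¹ := mul_pos hpr (inv_pos.2 ht0)
  have hM0 : 0 < M := by linarith
  refine ⟨⟨pw * t ^ d / M, div_nonneg a1 hM0.le, (div_le_one hM0).2 (by linarith)⟩,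
    ⟨pg / M, div_nonneg a2 hM0.le, (div_le_one hM0).2 (by linarith)⟩,
    ⟨pr * t⁻¹ / M, div_nonneg a3.le hM0.le, (div_le_one hM0).2 (by linarith)⟩, t, M, ?_, ht, hM0,
    by linarith, ?_, ?_, ?_⟩
  · simp only
    rw [← add_div, ← add_div, ← hMdef, div_self hM0.ne']
  · field_simp
  · field_simp
  · field_simp

/-- Multiplying the `P`-product by `t ^ d` per white vertex gives exactly `M ^ |A|` times the
`Q`-product times `t` per red vertex. The bound on the red vertices cancels all these powers of `t`
but one. -/
theorem prod_le_of_tilt {P Q : Colour → ℝ≥0∞} {t M : ℝ≥0∞} (ht0 : t ≠ 0) (ht : t ≠ ⊤) (ht1 : 1 ≤ t)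
    {d : ℕ} (hw : P .white * t ^ d = M * Q .white) (hg : P .green = M * Q .green)
    (hr : P .red = M * t * Q .red) (A : Finset V) (σ : V → Colour)
    (hA : (A.filter fun v => σ v = .red).card ≤
      1 + d * (A.filter fun v => σ v = .white).card) :
    ∏ v ∈ A, P (σ v) ≤ t * M ^ A.card * ∏ v ∈ A, Q (σ v) := by
  set k := (A.filter fun v => σ v = .white).card
  have h1 : ∏ v ∈ A, (P (σ v) * if σ v = .white then t ^ d else 1) =
      ∏ v ∈ A, (M * (Q (σ v) * if σ v = .red then t else 1)) := by
    refine Finset.prod_congr rfl fun v _ => ?_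
    cases σ v
    · simp [hw]
    · simp [hg]
    · simp [hr, mul_comm, mul_left_comm]
  simp only [Finset.prod_mul_distrib, Finset.prod_ite, Finset.prod_const, one_pow, mul_one] at h1
  have hk0 : (t ^ d) ^ k ≠ 0 := pow_ne_zero _ (pow_ne_zero _ ht0)
  have hk1 : (t ^ d) ^ k ≠ ⊤ := ENNReal.pow_ne_top (ENNReal.pow_ne_top ht)
  rw [← ENNReal.mul_le_mul_iff_left hk0 hk1, h1]
  calc _ ≤ M ^ A.card * ((∏ v ∈ A, Q (σ v)) * t ^ (1 + d * k)) := by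
        gcongr
    _ = _ := by
        rw [pow_add, pow_one, pow_mul]
        ring

/-! ### The law of the region -/

/-- The colouring given by `σ` on `A`, and green elsewhere. -/
def extendColour (A : Finset V) (σ : A → Colour) (v : V) : Colour :=
  if h : v ∈ A then σ ⟨v, h⟩ else .green

theorem extendColour_restrict {A : Finset V} {c : V → Colour} {v : V} (hv : v ∈ A) :
    extendColour A (fun w => c w) v = c v := by
  simp [extendColour, hv]

theorem finite_whiteCluster_extendColour (A : Finset V) (σ : A → Colour) (v : V) :
    (whiteCluster G (extendColour A σ) v).Finite := by
  refine A.finite_toSet.subset fun w hw => ?_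
  by_contra h
  have := white_of_mem_whiteCluster hw
  rw [extendColour, dif_neg (mt Finset.mem_coe.2 h)] at this
  cases this

/-- The inputs for which the colours on `A` are given by `σ` and for which, after round `n`, the
region is `A`. -/
def regionEvent (enc : G.Dart → ℕ) (x : V) (n : ℕ) (A : Finset V) (σ : A → Colour) :
    Set (Input G) :=
  ((A : Set V).pi fun v => {extendColour A σ v}) ×ˢ
    {τ | (run enc (extendColour A σ, τ) x n).region = A}

variable {D : ℕ} {x : V} {enc : G.Dart → ℕ}

/-- `run_congr` is applied from the extended colouring, whose white clusters are finite, so nothing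
is required of the white clusters of `ω`. -/
theorem region_of_mem_regionEvent
    (hdeg : ∀ v, (G.neighborSet v).Finite ∧ (G.neighborSet v).ncard ≤ D) {n : ℕ} {A : Finset V}
    {σ : A → Colour} (hx : extendColour A σ x = .green) {ω : Input G}
    (h : ω ∈ regionEvent enc x n A σ) : (run enc ω x n).region = A := by
  obtain ⟨h1, h2⟩ := h
  have := run_congr (enc := enc) (τ := ω.2) (c' := ω.1) hx hdeg
    (finite_whiteCluster_extendColour A σ) n fun v hv => by
      rw [h2] at hv
      exact (h1 v hv).symm
  rw [← h2, this]

theorem isProbabilityMeasure_exp : IsProbabilityMeasure (expMeasure 1) :=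
  isProbabilityMeasure_expMeasure one_pos

/-- The second factor does not involve the colour law, so two colour laws can be compared through
the finite product alone. -/
theorem inputLaw_regionEvent {pw pg pr : unitInterval} (hsum : (pw : ℝ) + pg + pr = 1) (n : ℕ)
    (A : Finset V) (σ : A → Colour) :
    inputLaw G pw pg pr (regionEvent enc x n A σ) =
      (∏ v ∈ A, colourLaw pw pg pr {extendColour A σ v}) *
        Measure.infinitePi (fun _ : G.edgeSet => expMeasure 1)
          {τ | (run enc (extendColour A σ, τ) x n).region = A} := by
  have := isProbabilityMeasure_colourLaw hsum
  have := isProbabilityMeasure_exp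
  rw [inputLaw, regionEvent, Measure.prod_prod, Measure.infinitePi_pi]
  exact fun _ _ => measurableSet_singleton _

/-- Exponential bound for the size of the region after `n` rounds. -/
theorem inputLaw_region_le [Countable V] (henc : Function.Injective enc)
    (hdeg : ∀ v, (G.neighborSet v).Finite ∧ (G.neighborSet v).ncard ≤ D)
    {pw pg pr qw qg qr : unitInterval} (hp : (pw : ℝ) + pg + pr = 1)
    (hq : (qw : ℝ) + qg + qr = 1) {t M : ℝ} (ht : 1 < t) (hM0 : 0 < M) (hM1 : M < 1)
    (hw : (pw : ℝ) * t ^ (D - 1) = M * qw) (hg : (pg : ℝ) = M * qg) (hr : (pr : ℝ) = M * t * qr)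
    (n m : ℕ) :
    inputLaw G pw pg pr {ω | ω.1 x = .green ∧ (∀ v, (whiteCluster G ω.1 v).Finite) ∧
      m ≤ (run enc ω x n).region.ncard} ≤ ENNReal.ofReal (t * M ^ m) := by
  have ht0 : 0 < t := by linarith
  -- The possible explored regions with their colours, restricted by what `Inv.count` leaves after
  -- dropping the active trees.
  let J := {p : Σ A : Finset V, (A → Colour) // m ≤ p.1.card ∧ extendColour p.1 p.2 x = .green ∧
    (p.1.filter fun v => extendColour p.1 p.2 v = .red).card ≤
      1 + (D - 1) * (p.1.filter fun v => extendColour p.1 p.2 v = .white).card}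
  let E : J → Set (Input G) := fun p => regionEvent enc x n p.1.1 p.1.2
  have hsub : {ω : Input G | ω.1 x = .green ∧ (∀ v, (whiteCluster G ω.1 v).Finite) ∧
      m ≤ (run enc ω x n).region.ncard} ⊆ ⋃ p, E p := by
    rintro ⟨c, τ⟩ ⟨hx, hc, hm⟩
    have hinv := Inv.run (enc := enc) (τ := τ) hx hdeg hc n
    set A := hinv.fin.toFinset with hA
    have hAR : (A : Set V) = (run enc (c, τ) x n).region := hinv.fin.coe_toFinset
    have hext : ∀ v ∈ A, extendColour A (fun w => c w) v = c v := fun v hv =>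
      extendColour_restrict hv
    have hfil : ∀ κ, (A.filter fun v => extendColour A (fun w => c w) v = κ).card =
        {v ∈ (run enc (c, τ) x n).region | c v = κ}.ncard := by
      intro κ
      rw [← hAR, ← Set.ncard_coe_finset]
      congr 1
      ext v
      simp only [Finset.coe_filter, mem_ofPred_eq, Finset.mem_coe]
      exact and_congr_right fun hv => by rw [hext v hv]
    have hmono := region_run_mono (enc := enc) (τ := τ) hx hdeg hc (Nat.zero_le n)
    have hxA : x ∈ A := by
      rw [← Finset.mem_coe, hAR]
      exact hmono (Or.inl (Or.inl (mem_vertsOf.2 ⟨_, rfl, by simp⟩)))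
    refine mem_iUnion.2 ⟨⟨⟨A, fun w => c w⟩, ?_, ?_, ?_⟩, ?_, ?_⟩
    · rwa [← Set.ncard_coe_finset, hAR]
    · rw [← hx]
      exact hext x hxA
    · simp only [hfil]
      exact (Nat.le_add_left _ _).trans hinv.count
    · exact fun v hv => (hext v hv).symm
    · change (run enc (extendColour A fun w => c w, τ) x n).region = A
      rw [← run_congr hx hdeg hc n fun v hv => ?_, hAR]
      rw [← hAR] at hv
      exact (hext v hv).symm
  -- The region after round `n` recovers `A`, and the colours on `A` then recover `σ`.
  have hdisj : Pairwise fun p q => Disjoint (E p) (E q) := by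
    rintro ⟨⟨A, σ⟩, h1, h2, h3⟩ ⟨⟨B, ρ⟩, k1, k2, k3⟩ hne
    rw [Set.disjoint_left]
    intro ω hω hω'
    apply hne
    have e1 := region_of_mem_regionEvent hdeg h2 hω
    have e2 := region_of_mem_regionEvent hdeg k2 hω'
    have hAB : A = B := Finset.coe_injective (e1.symm.trans e2)
    subst hAB
    have : σ = ρ := by
      funext v
      have f1 := hω.1 v v.2
      have f2 := hω'.1 v v.2
      simp only [extendColour, v.2, dif_pos, mem_singleton_iff] at f1 f2
      rw [← f1, f2]
    subst this
    rfl
  have hmeas : ∀ p, MeasurableSet (E p) := fun p =>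
    (MeasurableSet.pi (Finset.countable_toSet _) fun _ _ => measurableSet_singleton _).prod
      (measurableSet_region_run henc n _)
  have hM : ENNReal.ofReal M ≤ 1 := by
    rw [← ENNReal.ofReal_one]; exact ENNReal.ofReal_le_ofReal hM1.le
  have hle : ∀ p, inputLaw G pw pg pr (E p) ≤
      ENNReal.ofReal (t * M ^ m) * inputLaw G qw qg qr (E p) := by
    rintro ⟨⟨A, σ⟩, h1, h2, h3⟩
    have key := prod_le_of_tilt (P := fun κ => colourLaw pw pg pr {κ})
      (Q := fun κ => colourLaw qw qg qr {κ}) (t := ENNReal.ofReal t) (M := ENNReal.ofReal M)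
      (d := D - 1) (by simpa using ht0) ENNReal.ofReal_ne_top
      (by rw [← ENNReal.ofReal_one]; exact ENNReal.ofReal_le_ofReal ht.le)
      (by
        simp only [colourLaw_white]
        rw [← ENNReal.ofReal_pow ht0.le, ← ENNReal.ofReal_mul pw.2.1, ← ENNReal.ofReal_mul hM0.le,
          hw])
      (by
        simp only [colourLaw_green]
        rw [← ENNReal.ofReal_mul hM0.le, hg])
      (by
        simp only [colourLaw_red]
        rw [← ENNReal.ofReal_mul hM0.le, ← ENNReal.ofReal_mul (mul_nonneg hM0.le ht0.le), hr])
      A (extendColour A σ) h3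
    change inputLaw G pw pg pr (regionEvent enc x n A σ) ≤
      _ * inputLaw G qw qg qr (regionEvent enc x n A σ)
    rw [inputLaw_regionEvent hp, inputLaw_regionEvent hq, ← mul_assoc]
    gcongr
    refine key.trans ?_
    rw [ENNReal.ofReal_mul ht0.le, ENNReal.ofReal_pow hM0.le]
    exact mul_le_mul' (mul_le_mul' le_rfl (pow_le_pow_right_of_le_one' hM h1)) le_rfl
  have := isProbabilityMeasure_colourLaw hq
  have := isProbabilityMeasure_exp
  have : IsProbabilityMeasure (inputLaw G qw qg qr) := by
    unfold inputLaw
    infer_instance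
  calc _ ≤ inputLaw G pw pg pr (⋃ p, E p) := measure_mono hsub
    _ ≤ ∑' p, inputLaw G pw pg pr (E p) := measure_iUnion_le _
    _ ≤ ∑' p, ENNReal.ofReal (t * M ^ m) * inputLaw G qw qg qr (E p) := ENNReal.tsum_le_tsum hle
    -- Under the tilted law the disjoint events have total mass at most one, which replaces a union
    -- bound over the sets `A`.
    _ = ENNReal.ofReal (t * M ^ m) * inputLaw G qw qg qr (⋃ p, E p) := by
        rw [ENNReal.tsum_mul_left, measure_iUnion hdisj hmeas]
    _ ≤ ENNReal.ofReal (t * M ^ m) * 1 := by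
        gcongr
        exact prob_le_one
    _ = _ := mul_one _

/-- The bound is uniform in the round and the events increase with it; continuity along increasing
unions needs no measurability. -/
theorem inputLaw_exists_region_le [Countable V] (henc : Function.Injective enc)
    (hdeg : ∀ v, (G.neighborSet v).Finite ∧ (G.neighborSet v).ncard ≤ D)
    {pw pg pr : unitInterval} (hp : (pw : ℝ) + pg + pr = 1)
    (hlt : ((D - 1 : ℕ) : ℝ) * pw < pr) (x : V) :
    ∃ t M : ℝ, 0 < t ∧ 0 < M ∧ M < 1 ∧ ∀ m : ℕ,
      inputLaw G pw pg pr {ω | ω.1 x = .green ∧ (∀ v, (whiteCluster G ω.1 v).Finite) ∧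
        ∃ n, m ≤ (run enc ω x n).region.ncard} ≤ ENNReal.ofReal (t * M ^ m) := by
  obtain ⟨qw, qg, qr, t, M, hq, ht, hM0, hM1, hw, hg, hr⟩ := exists_tilted_law hp _ hlt
  refine ⟨t, M, by linarith, hM0, hM1, fun m => ?_⟩
  have hU : {ω : Input G | ω.1 x = .green ∧ (∀ v, (whiteCluster G ω.1 v).Finite) ∧
        ∃ n, m ≤ (run enc ω x n).region.ncard} =
      ⋃ n, {ω : Input G | ω.1 x = .green ∧ (∀ v, (whiteCluster G ω.1 v).Finite) ∧
        m ≤ (run enc ω x n).region.ncard} := by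
    ext ω
    simp only [mem_iUnion, mem_ofPred_eq]
    tauto
  rw [hU, Monotone.measure_iUnion]
  · exact iSup_le fun n => inputLaw_region_le henc hdeg hp hq ht hM0 hM1 hw hg hr n m
  · rintro n k hnk ⟨c, τ⟩ ⟨hx, hc, hm⟩
    exact ⟨hx, hc, hm.trans (ncard_le_ncard (region_run_mono hx hdeg hc hnk)
      (Inv.run hx hdeg hc k).fin)⟩

end

section

/-! ### Finiteness of the white clusters -/

theorem measurableSet_mem_cluster [Countable V] (u v : V) :
    MeasurableSet {A : Set V | u ∈ cluster G A v} := by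
  have : Countable (G.Walk v u) :=
    Function.Injective.countable (f := SimpleGraph.Walk.support)
      fun p q h => SimpleGraph.Walk.ext_support h
  have h : {A : Set V | u ∈ cluster G A v} =
      ⋃ p : G.Walk v u, ⋂ w ∈ {w | w ∈ p.support}, {A : Set V | w ∈ A} := by
    ext A
    simp [cluster]
  rw [h]
  exact MeasurableSet.iUnion fun p => MeasurableSet.biInter (to_countable _) fun w _ =>
    measurableSet_setOfPred.2 (measurable_set_mem w)

theorem measurableSet_infinite_cluster [Countable V] (v : V) :
    MeasurableSet {A : Set V | (cluster G A v).Infinite} := by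
  have h : {A : Set V | (cluster G A v).Infinite} =
      ⋂ F : Finset V, ⋃ u : V, ⋃ _ : u ∉ F, {A : Set V | u ∈ cluster G A v} := by
    ext A
    simp only [mem_ofPred_eq, mem_iInter, mem_iUnion, exists_prop]
    constructor
    · intro hA F
      obtain ⟨u, h1, h2⟩ := hA.exists_notMem_finset F
      exact ⟨u, h2, h1⟩
    · intro hA hf
      obtain ⟨u, h1, h2⟩ := hA hf.toFinset
      exact h1 (hf.mem_toFinset.2 h2)
  rw [h]
  exact MeasurableSet.iInter fun F => MeasurableSet.iUnion fun u => MeasurableSet.iUnion fun _ =>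
    measurableSet_mem_cluster u v

theorem setBernoulli_le_xiAt [Countable V] (p : unitInterval) (v : V) :
    setBernoulli (univ : Set V) p {A | v ∈ A} ≤ xiAt G p v := by
  have hm : MeasurableSet {A : Set V | v ∈ A} := measurableSet_setOfPred.2 (measurable_set_mem v)
  rw [← one_mul (setBernoulli _ _ _), ← lintegral_indicator_const hm 1]
  refine lintegral_mono (indicator_le fun A hA => ?_)
  have : (1 : ℕ∞) ≤ (cluster G A v).encard := one_le_encard_iff_nonempty.2 ⟨v, mem_cluster_self hA⟩
  exact_mod_cast this

/-- An infinite cluster with positive probability would make the expected size infinite. -/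
theorem setBernoulli_infinite_cluster [Countable V] {p : unitInterval} {v : V}
    (h : xiAt G p v ≠ ⊤) :
    setBernoulli (univ : Set V) p {A | (cluster G A v).Infinite} = 0 := by
  by_contra h0
  refine h (top_le_iff.1 ?_)
  rw [← ENNReal.top_mul h0, ← lintegral_indicator_const (measurableSet_infinite_cluster v) ⊤]
  refine lintegral_mono (indicator_le fun A hA => ?_)
  have : (cluster G A v).encard = ⊤ := encard_eq_top_iff.2 hA
  simp [this]

variable {pw pg pr : unitInterval}

theorem map_colourLaw (hp : (pw : ℝ) + pg + pr = 1) :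
    (colourLaw pw pg pr).map (fun κ => κ = Colour.white) =
      unitInterval.toNNReal pw • Measure.dirac True +
        unitInterval.toNNReal (unitInterval.symm pw) • Measure.dirac False := by
  have hm : Measurable fun κ => κ = Colour.white := fun _ _ => trivial
  have e1 : ENNReal.ofReal pw = (unitInterval.toNNReal pw : ℝ≥0∞) := by
    rw [ENNReal.ofReal_eq_coe_nnreal pw.2.1]; rfl
  have e2 : ENNReal.ofReal pg + ENNReal.ofReal pr =
      (unitInterval.toNNReal (unitInterval.symm pw) : ℝ≥0∞) := by
    rw [← ENNReal.ofReal_add pg.2.1 pr.2.1, show (pg : ℝ) + pr = (unitInterval.symm pw : ℝ) by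
      simp only [unitInterval.coe_symm_eq]; linarith,
      ENNReal.ofReal_eq_coe_nnreal (unitInterval.symm pw).2.1]
    rfl
  rw [colourLaw, Measure.map_add _ _ hm, Measure.map_add _ _ hm, Measure.map_smul,
    Measure.map_smul, Measure.map_smul, Measure.map_dirac' hm, Measure.map_dirac' hm,
    Measure.map_dirac' hm, add_assoc]
  simp only [reduceCtorEq]
  rw [← add_smul, e1, e2]
  rfl

theorem map_infinitePi_colourLaw (hp : (pw : ℝ) + pg + pr = 1) :
    (Measure.infinitePi fun _ : V => colourLaw pw pg pr).map
      (fun c => {v | c v = Colour.white}) = setBernoulli (univ : Set V) pw := by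
  have := isProbabilityMeasure_colourLaw hp
  have hm : Measurable fun κ => κ = Colour.white := fun _ _ => trivial
  have h1 := Measure.infinitePi_map_pi (fun _ : V => colourLaw pw pg pr) fun _ => hm
  rw [setBernoulli_eq_map]
  simp only [mem_univ]
  rw [← map_colourLaw hp, ← h1, Measure.map_map]
  · rfl
  · exact MeasurableEquiv.setOfPred.measurable
  · fun_prop

theorem inputLaw_infinite_whiteCluster [Countable V] (hp : (pw : ℝ) + pg + pr = 1)
    (h : ∀ v, xiAt G pw v ≠ ⊤) :
    inputLaw G pw pg pr {ω | ¬ ∀ v, (whiteCluster G ω.1 v).Finite} = 0 := by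
  have := isProbabilityMeasure_exp
  have hU : {ω : Input G | ¬ ∀ v, (whiteCluster G ω.1 v).Finite} =
      ⋃ v, {c | (whiteCluster G c v).Infinite} ×ˢ univ := by
    ext ω
    simp only [mem_ofPred_eq, mem_iUnion, mem_prod, mem_univ, and_true, not_forall]
    rfl
  rw [hU, measure_iUnion_null_iff]
  intro v
  have hm : Measurable fun c : V → Colour => {v | c v = Colour.white} := by
    refine MeasurableEquiv.setOfPred.measurable.comp
      (measurable_pi_lambda (fun (c : V → Colour) v => c v = Colour.white) fun v => ?_)
    exact (show Measurable fun κ => κ = Colour.white from fun _ _ => trivial).comp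
      (measurable_pi_apply v)
  have := setBernoulli_infinite_cluster (h v)
  rw [← map_infinitePi_colourLaw hp,
    Measure.map_apply hm (measurableSet_infinite_cluster v)] at this
  rw [inputLaw, Measure.prod_prod]
  exact mul_eq_zero_of_left this _

theorem setBernoulli_mem (hp : (pw : ℝ) + pg + pr = 1) (v : V) :
    setBernoulli (univ : Set V) pw {A | v ∈ A} = ENNReal.ofReal pw := by
  have := isProbabilityMeasure_colourLaw hp
  have hm : Measurable fun c : V → Colour => {v | c v = Colour.white} := by
    refine MeasurableEquiv.setOfPred.measurable.comp
      (measurable_pi_lambda (fun (c : V → Colour) v => c v = Colour.white) fun v => ?_)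
    exact (show Measurable fun κ => κ = Colour.white from fun _ _ => trivial).comp
      (measurable_pi_apply v)
  rw [← map_infinitePi_colourLaw hp,
    Measure.map_apply hm (measurableSet_setOfPred.2 (measurable_set_mem v)), ← colourLaw_white pw pg pr]
  conv_rhs => rw [← Measure.infinitePi_map_eval (fun _ : V => colourLaw pw pg pr) v]
  rw [Measure.map_apply (measurable_pi_apply v) (measurableSet_singleton _)]
  rfl

/-! ### Exponential tails -/

/-- With all degrees at most one, a connected graph has at most two vertices. The bound excludes `D
- 1 = 0`, for which `(D - 1) * ξ` would say nothing about the finiteness of `ξ`. -/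
theorem two_le_of_degree_le [Infinite V] (hG : G.Connected) {D : ℕ}
    (hdeg : ∀ v, (G.neighborSet v).Finite ∧ (G.neighborSet v).ncard ≤ D) : 2 ≤ D := by
  by_contra! hD
  have hsub : ∀ a b c, G.Adj a b → G.Adj a c → b = c := by
    intro a b c hb hc
    have := hdeg a
    exact (ncard_le_one_iff this.1).1 (by omega) hb hc
  obtain ⟨x⟩ := hG.nonempty
  obtain ⟨y, hy⟩ := exists_ne x
  have hx : ∃ z, G.Adj x z := by
    obtain ⟨p⟩ := hG.preconnected x y
    cases p with
    | nil => exact absurd rfl hy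
    | cons h p => exact ⟨_, h⟩
  obtain ⟨z, hz⟩ := hx
  refine infinite_univ ((toFinite {x, z}).subset fun u _ => ?_)
  obtain ⟨p⟩ := hG.preconnected x u
  refine mem_of_walk (A := univ) (fun a ha b _ hab => ?_) p (fun _ _ => mem_univ _)
    (mem_insert _ _)
  rcases ha with rfl | rfl
  · exact Or.inr (hsub _ _ _ hab hz)
  · exact Or.inl (hsub _ _ _ hab hz.symm)

variable {D : ℕ} {x : V} {enc : G.Dart → ℕ}

/-- Events which, up to a null set, imply that the region gets large have exponentially small
conditional probability. -/
theorem inputLawGreen_le [Countable V] (henc : Function.Injective enc)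
    (hdeg : ∀ v, (G.neighborSet v).Finite ∧ (G.neighborSet v).ncard ≤ D)
    (hp : (pw : ℝ) + pg + pr = 1) (hlt : ((D - 1 : ℕ) : ℝ) * pw < pr)
    (hxi : ∀ v, xiAt G pw v ≠ ⊤) (x : V) :
    ∃ C a : ℝ, 0 < C ∧ 0 < a ∧ ∀ (m : ℕ) (F : Set (Input G)),
      (∀ c τ, c x = .green → (∀ v, (whiteCluster G c v).Finite) → (c, τ) ∈ F →
        ∃ n, m ≤ (run enc (c, τ) x n).region.ncard) →
      inputLawGreen G pw pg pr x F ≤ ENNReal.ofReal (C * Real.exp (-a * m)) := by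
  obtain ⟨t, M, ht, hM0, hM1, hb⟩ := inputLaw_exists_region_le henc hdeg hp hlt x
  have := isProbabilityMeasure_colourLaw hp
  have := isProbabilityMeasure_exp
  have hgreen : inputLaw G pw pg pr {ω | ω.1 x = .green} = ENNReal.ofReal pg := by
    have h1 : {ω : Input G | ω.1 x = .green} = {c : V → Colour | c x = .green} ×ˢ univ := by
      ext ω; simp
    rw [h1, inputLaw, Measure.prod_prod, measure_univ, mul_one, ← colourLaw_green pw pg pr]
    conv_rhs => rw [← Measure.infinitePi_map_eval (fun _ : V => colourLaw pw pg pr) x]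
    rw [Measure.map_apply (measurable_pi_apply x) (measurableSet_singleton _)]
    rfl
  have hmeas : MeasurableSet {ω : Input G | ω.1 x = .green} :=
    (show Measurable fun ω : Input G => ω.1 x from
      (measurable_pi_apply x).comp measurable_fst) (measurableSet_singleton Colour.green)
  -- If `pg = 0` the conditional measure is zero and any constants serve.
  rcases pg.2.1.eq_or_lt with h0 | h0
  · refine ⟨1, 1, one_pos, one_pos, fun m F _ => ?_⟩
    rw [inputLawGreen, cond_eq_zero_of_meas_eq_zero (by rw [hgreen, ← h0, ENNReal.ofReal_zero])]
    exact zero_le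
  -- Conditioning costs the factor `1 / pg`, and `M ^ m = exp (m * log M)`.
  refine ⟨t / pg, -Real.log M, div_pos ht h0, neg_pos.2 (Real.log_neg hM0 hM1), fun m F hF => ?_⟩
  have hexp : Real.exp (- -Real.log M * m) = M ^ m := by
    rw [neg_neg, mul_comm, ← Real.log_pow, Real.exp_log (pow_pos hM0 _)]
  rw [hexp, inputLawGreen, cond_apply hmeas, hgreen, div_mul_eq_mul_div, div_eq_inv_mul,
    ENNReal.ofReal_mul (inv_nonneg.2 h0.le), ENNReal.ofReal_inv_of_pos h0]
  gcongr
  refine le_trans ?_ (hb m)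
  have hsub : {ω : Input G | ω.1 x = .green} ∩ F ⊆
      {ω | ω.1 x = .green ∧ (∀ v, (whiteCluster G ω.1 v).Finite) ∧
        ∃ n, m ≤ (run enc ω x n).region.ncard} ∪
      {ω | ¬ ∀ v, (whiteCluster G ω.1 v).Finite} := by
    rintro ⟨c, τ⟩ ⟨h1, h2⟩
    by_cases hc : ∀ v, (whiteCluster G c v).Finite
    · exact Or.inl ⟨h1, hc, hF c τ h1 hc h2⟩
    · exact Or.inr hc
  refine (measure_mono hsub).trans ((measure_union_le _ _).trans ?_)
  rw [inputLaw_infinite_whiteCluster hp hxi, add_zero]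

end

end

end ParalyzingGrowth

/-! ### The hypothesis on `ξ` and the conclusion -/

open ParalyzingGrowth in
theorem proposition3p1 {V : Type*} [Countable V] [Infinite V]
    (G : SimpleGraph V) [G.LocallyFinite] (hconn : G.Connected)
    (D : ℕ) (hD : IsGreatest (Set.range fun v => G.degree v) D)
    (enc : G.Dart → ℕ) (henc : Function.Injective enc)
    (pw pg pr : unitInterval) (hsum : (pw : ℝ) + pg + pr = 1)
    (hcond : ((D : ENNReal) - 1) * ParalyzingGrowth.xi G pw < ENNReal.ofReal pr)
    (x : V) :
    (∀ᵐ ω ∂(ParalyzingGrowth.inputLawGreen G pw pg pr x), ParalyzingGrowth.Stops enc ω x) ∧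
    ParalyzingGrowth.HasExpTail (ParalyzingGrowth.inputLawGreen G pw pg pr x)
      (fun ω => (ParalyzingGrowth.outputGraph enc ω x).verts.encard) ∧
    ParalyzingGrowth.HasExpTail (ParalyzingGrowth.inputLawGreen G pw pg pr x)
      (fun ω => (ParalyzingGrowth.outputGraph enc ω x).coe.ediam) ∧
    ParalyzingGrowth.HasExpTail (ParalyzingGrowth.inputLawGreen G pw pg pr x)
      (fun ω => ParalyzingGrowth.setDiam G (ParalyzingGrowth.outputGraph enc ω x).verts) := by
  have hdeg : ∀ v, (G.neighborSet v).Finite ∧ (G.neighborSet v).ncard ≤ D := fun v => by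
    refine ⟨Set.toFinite _, ?_⟩
    rw [Set.ncard_eq_toFinset_card', Set.toFinset_card, SimpleGraph.card_neighborSet_eq_degree]
    exact hD.2 ⟨v, rfl⟩
  have hD2 := two_le_of_degree_le hconn hdeg
  have hD1 : (D : ENNReal) - 1 = ((D - 1 : ℕ) : ENNReal) := by
    rw [ENNReal.natCast_sub, Nat.cast_one]
  rw [hD1] at hcond
  have hne : ((D - 1 : ℕ) : ENNReal) ≠ 0 := by
    rw [Nat.cast_ne_zero]; omega
  have hxi : ∀ v, xiAt G pw v ≠ ⊤ := by
    intro v hv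
    have h1 : xi G pw = ⊤ := top_le_iff.1 (hv ▸ le_iSup (xiAt G pw) v)
    rw [h1, ENNReal.mul_top hne] at hcond
    exact not_top_lt hcond
  -- The cluster of an occupied vertex has at least one vertex, so `ξ(pw) ≥ pw`.
  have hlt : ((D - 1 : ℕ) : ℝ) * pw < pr := by
    have h1 : ENNReal.ofReal pw ≤ xi G pw := by
      rw [← setBernoulli_mem hsum x]
      exact (setBernoulli_le_xiAt pw x).trans (le_iSup (xiAt G pw) x)
    have h2 := (mul_le_mul_right h1 ((D - 1 : ℕ) : ENNReal)).trans_lt hcond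
    rw [← ENNReal.ofReal_natCast, ← ENNReal.ofReal_mul (Nat.cast_nonneg _)] at h2
    exact (ENNReal.ofReal_lt_ofReal_iff_of_nonneg
      (mul_nonneg (Nat.cast_nonneg _) pw.2.1)).1 h2
  obtain ⟨C, a, hC, ha, hb⟩ := inputLawGreen_le henc hdeg hsum hlt hxi x
  refine ⟨?_, ⟨C, a, hC, ha, fun n => hb n _ fun c τ hx hc h => ?_⟩,
    ⟨C, a, hC, ha, fun n => hb n _ fun c τ hx hc h => ?_⟩,
    ⟨C, a, hC, ha, fun n => hb n _ fun c τ hx hc h => ?_⟩⟩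
  · rw [MeasureTheory.ae_iff]
    -- If the algorithm never stops, the region exceeds every size, so the tail bound applies for
    -- all `n` at once and tends to zero.
    have hle : ∀ n : ℕ, inputLawGreen G pw pg pr x {ω | ¬ Stops enc ω x} ≤
        ENNReal.ofReal (C * Real.exp (-a * n)) := fun n => hb n _ fun c τ hx hc h =>
      exists_le_region hconn hx hdeg hc (Or.inl h)
    have hlim : Filter.Tendsto (fun n : ℕ => ENNReal.ofReal (C * Real.exp (-a * n))) Filter.atTop
        (nhds 0) := by
      rw [← ENNReal.ofReal_zero, ← mul_zero C]
      refine ENNReal.tendsto_ofReal (Filter.Tendsto.const_mul C ?_)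
      refine Real.tendsto_exp_atBot.comp ?_
      exact (tendsto_natCast_atTop_atTop).const_mul_atTop_of_neg (neg_neg_of_pos ha)
    exact le_antisymm (ge_of_tendsto' hlim hle) zero_le
  · exact exists_le_region hconn hx hdeg hc (Or.inr (Or.inl h))
  · exact exists_le_region hconn hx hdeg hc (Or.inr (Or.inr (Or.inl h)))
  · exact exists_le_region hconn hx hdeg hc (Or.inr (Or.inr (Or.inr h)))
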